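/- Let $d\ge 1$, let $W\subset\mathbb R^d$ be a compact convex set with volume $V(W)>0$, let $t>0$, $\delta_t>0$ and $\alpha\ge 0$, and let $\kappa_d$ be the volume of the $d$-dimensional Euclidean unit ball. Let $\eta_t$ be a homogeneous Poisson point process of intensity $t$ in $W$, that is, a random finite set of distinct points of $W$ such that $\mathbb P(\eta_t\cap A=\emptyset)=e^{-t\lambda(A)}$ for every Borel set $A\subset W$, where $\lambda$ is Lebesgue measure. Let $$L_t^{(\alpha)}=\frac12\sum_{(x,y)\in\eta_t^2,\ x\ne y}\mathbf 1(\|x-y\|\le\delta_t)\,\|x-y\|^\alpha ,$$ and let $m_t$ be a median of $L_t^{(\alpha)}$, that is, $\mathbb P(L_t^{(\alpha)}\le m_t)\ge\frac12$ and $\mathbb P(L_t^{(\alpha)}\ge m_t)\ge\frac12$. For $u\ge 0$ define $$x^*(u,t)=\inf_{s>0}\left\{\frac{\frac{\ln(tV(W))}{t\kappa_d\delta_t^d}+e^s-1}{2s}+\sqrt{\frac{u^2}{8t^2\kappa_d^2\delta_t^{2d+\alpha}(u+m_t)s}+\left(\frac{\frac{\ln(tV(W))}{t\kappa_d\delta_t^d}+e^s-1}{2s}\right)^2}\,\right\}.$$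 Then, for every $u\ge 0$, $$\mathbb P\big(|L_t^{(\alpha)}-m_t|\ge u\big)\le 8\exp\left(-\frac{u^2}{8\,t\,\kappa_d\,\delta_t^{d+\alpha}\,x^*(u,t)\,(u+m_t)}\right),$$ and, in particular, $$\mathbb P\big(|L_t^{(\alpha)}-m_t|\ge u\big)\le 8\exp\left(-\frac12\min\left\{\frac{u^2}{8\big(\ln(tV(W))\,\delta_t^\alpha+2t\kappa_d\delta_t^{d+\alpha}\big)(u+m_t)},\ \frac{u}{\sqrt{8\delta_t^\alpha(u+m_t)}}\right\}\right).$$ Here a quotient with denominator $0$ is read as $0$. -/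

import Mathlib

open MeasureTheory

namespace Gilbert

noncomputable section

/-- `ℝ^d` with the Euclidean norm (and Lebesgue measure `volume`). -/
abbrev E (d : ℕ) : Type := EuclideanSpace ℝ (Fin d)

/-- The space `N(W)` of finite configurations of distinct points of `W`; a configuration `ξ` is
identified with the finite simple counting measure `∑_{x ∈ ξ} δ_x`. -/
structure PointConfig {d : ℕ} (W : Set (E d)) where
  /-- the points of the configuration -/
  points : Finset (E d)
  /-- all points lie in `W` -/
  subset : (points : Set (E d)) ⊆ W

/-- The evaluation `ξ(A)`: the number of points of `ξ` that lie in `A`. -/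
def PointConfig.count {d : ℕ} {W : Set (E d)} (ξ : PointConfig W) (A : Set (E d)) : ℕ :=
  ((ξ.points : Set (E d)) ∩ A).ncard

/-- The σ-field on `N(W)` generated by the evaluations `ξ ↦ ξ(A)`, for Borel sets `A ⊆ W`. -/
instance PointConfig.instMeasurableSpace {d : ℕ} (W : Set (E d)) :
    MeasurableSpace (PointConfig W) :=
  ⨆ (A : Set (E d)) (_ : MeasurableSet A) (_ : A ⊆ W),
    MeasurableSpace.comap (fun ξ : PointConfig W => ξ.count A) ⊤

/-- `η` is a homogeneous Poisson point process of intensity `t` in `W`: a random element of `N(W)`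
with `P(η(A) = 0) = exp(-t λ(A))` for every Borel set `A ⊆ W`. (As `N(W)` consists of simple
configurations, these probabilities determine the law of `η`.) -/
structure IsPoissonProcess {Ω : Type*} [MeasurableSpace Ω] (P : Measure Ω) {d : ℕ}
    (W : Set (E d)) (t : ℝ) (η : Ω → PointConfig W) : Prop where
  measurable : Measurable η
  void_prob : ∀ A : Set (E d), MeasurableSet A → A ⊆ W →
    P.real {ω | (η ω).count A = 0} = Real.exp (-(t * volume.real A))

open Classical in
/-- The length-power functional of the Gilbert graph on the configuration `ξ`:
`½ ∑ 1(‖x - y‖ ≤ δ) ‖x - y‖^α`, over all ordered pairs `(x, y)` of distinct points of `ξ`. -/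
def lengthPower {d : ℕ} {W : Set (E d)} (α δ : ℝ) (ξ : PointConfig W) : ℝ :=
  (1 / 2) * ∑ p ∈ ξ.points.offDiag, if ‖p.1 - p.2‖ ≤ δ then ‖p.1 - p.2‖ ^ α else 0

/-- `m` is a median of the real random variable `X`. -/
def IsMedian {Ω : Type*} [MeasurableSpace Ω] (P : Measure Ω) (X : Ω → ℝ) (m : ℝ) : Prop :=
  1 / 2 ≤ P.real {ω | X ω ≤ m} ∧ 1 / 2 ≤ P.real {ω | m ≤ X ω}

/-- `κ_d`, the volume of the `d`-dimensional Euclidean unit ball. -/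
def κ (d : ℕ) : ℝ := volume.real (Metric.closedBall (0 : E d) 1)

/-- `(ln(t V) / (t κ_d δ^d) + e^s - 1) / (2 s)`. -/
def xLinear (d : ℕ) (t δ V s : ℝ) : ℝ :=
  (Real.log (t * V) / (t * κ d * δ ^ d) + Real.exp s - 1) / (2 * s)

/-- The function of `s` whose infimum over `s > 0` is `x*`. -/
def xFun (d : ℕ) (α t δ V m u s : ℝ) : ℝ :=
  xLinear d t δ V s +
    √(u ^ 2 / (8 * t ^ 2 * κ d ^ 2 * δ ^ (2 * (d : ℝ) + α) * (u + m) * s)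
      + xLinear d t δ V s ^ 2)

/-- `x*(u, t) = inf_{s > 0} xFun s`. -/
def xStar (d : ℕ) (α t δ V m u : ℝ) : ℝ :=
  sInf (xFun d α t δ V m u '' Set.Ioi 0)

/-- The infimum defining `x*` is a genuine one: it is over a nonempty set bounded below by `0`. -/
theorem xStar_isGLB (d : ℕ) {α t δ V m u : ℝ} (hδ : 0 < δ) (hm : 0 ≤ u + m) :
    IsGLB (xFun d α t δ V m u '' Set.Ioi 0) (xStar d α t δ V m u) := by
  refine isGLB_csInf ⟨_, 1, Set.mem_Ioi.2 one_pos, rfl⟩ ⟨0, ?_⟩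
  rintro _ ⟨s, hs, rfl⟩
  have hs' : 0 < s := hs
  have hb : 0 ≤ u ^ 2 / (8 * t ^ 2 * κ d ^ 2 * δ ^ (2 * (d : ℝ) + α) * (u + m) * s) := by
    positivity
  have h1 := Real.abs_le_sqrt (le_add_of_nonneg_left hb :
    xLinear d t δ V s ^ 2 ≤ _ + xLinear d t δ V s ^ 2)
  have h2 := neg_abs_le (xLinear d t δ V s)
  unfold xFun
  linarith

end

end Gilbert

/-!
Concentration of the length-power functional around its median rests on Talagrand's convex distance
inequality. For configurations `T` and `U`, deleting the points of `T \ U` shows that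
`L(T) - L(U) ≤ ∑_{x ∈ T \ U} F(x, T)`, where `F(x, T)` is the contribution of the pairs that
contain `x` (`pairSum_le_add`). As `∑ F(x, T) ^ 2 ≤ max F * ∑ F = 2 * L(T) * max F`, the convex
distance from `T` to `{L ≤ a}` is large if `L(T)` exceeds `a` and `max F` is under control
(`ConvexDistSqLE.le_of_pairSum`). Since `F(x, T) ≤ δ ^ α * deg x`, this is a matter of the maximal
degree, which a Chernoff bound controls (`bernoulliProb_degree_le`). The two errors are
`exp (-u ^ 2 / (8 δ ^ α D (u + m)))` and `t V exp ((exp s - 1) t κ δ ^ d - s D)`, where `D` is the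
threshold for the degree. With `D = t κ δ ^ d x`, equating them is a quadratic equation for `x`,
whose positive root is `xFun` (`xFun_quadratic`); the infimum over `s` and the choice `s = 1` give
the two bounds.

No theory of Poisson processes is needed beyond the void probabilities. Cut `W` into finitely many
cells of small diameter and replace each point of the process by the label of its cell. By the void
probabilities the set of occupied cells is a random subset of a finite set with independent
memberships (`prob_image_points_mem`), so the convex distance inequality is needed for such
subsets only; there it is proved by induction on the ground set (`exists_convexDistSqLE`). A
configuration is finite, so for fine partitions its points lie in different cells, and the
discretised functionals converge pointwise (`tendsto_pairSum_image`). The inequality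
`ℙ(L ≤ a) * (ℙ(L ≥ b) - error) ≤ exp (-(b - a) ^ 2 / (8 b δ ^ α D))` survives the limit
(`prob_mul_sub_le_of_tendsto`), and with `a` or `b` equal to the median it gives the two tails
(`Gilbert.IsMedian.prob_abs_sub_le`).
-/

/-! ### Random subsets with independent membership -/

/-- The probability that the random subset of `S` which contains each `i ∈ S` independently with
probability `p i` equals `T ⊆ S`. -/
def bernoulliWeight {ι : Type*} [DecidableEq ι] (p : ι → ℝ) (S T : Finset ι) : ℝ :=
  (∏ i ∈ T, p i) * ∏ i ∈ S \ T, (1 - p i)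

/-- The expectation of `φ` at the random subset of `S` which contains each `i ∈ S` independently
with probability `p i`. -/
def bernoulliMean {ι : Type*} [DecidableEq ι] (p : ι → ℝ) (S : Finset ι)
    (φ : Finset ι → ℝ) : ℝ :=
  ∑ T ∈ S.powerset, bernoulliWeight p S T * φ T

/-- The probability that the random subset of `S` which contains each `i ∈ S` independently with
probability `p i` belongs to the family `A`. -/
noncomputable def bernoulliProb {ι : Type*} [DecidableEq ι] (p : ι → ℝ) (S : Finset ι)
    (A : Set (Finset ι)) : ℝ :=
  bernoulliMean p S (A.indicator 1)

section Bernoulli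

variable {ι : Type*} [DecidableEq ι] {p : ι → ℝ} {S : Finset ι}

theorem bernoulliWeight_nonneg (hp : ∀ i, p i ∈ Set.Icc (0 : ℝ) 1) (T : Finset ι) :
    0 ≤ bernoulliWeight p S T :=
  mul_nonneg (Finset.prod_nonneg fun i _ => (hp i).1)
    (Finset.prod_nonneg fun i _ => sub_nonneg.2 (hp i).2)

theorem bernoulliMean_mono (hp : ∀ i, p i ∈ Set.Icc (0 : ℝ) 1) {φ ψ : Finset ι → ℝ}
    (h : ∀ T ⊆ S, φ T ≤ ψ T) : bernoulliMean p S φ ≤ bernoulliMean p S ψ :=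
  Finset.sum_le_sum fun T hT =>
    mul_le_mul_of_nonneg_left (h T (Finset.mem_powerset.1 hT)) (bernoulliWeight_nonneg hp T)

theorem bernoulliMean_add (φ ψ : Finset ι → ℝ) :
    bernoulliMean p S (fun T => φ T + ψ T) = bernoulliMean p S φ + bernoulliMean p S ψ := by
  simp only [bernoulliMean, mul_add, Finset.sum_add_distrib]

theorem bernoulliMean_const_mul (c : ℝ) (φ : Finset ι → ℝ) :
    bernoulliMean p S (fun T => c * φ T) = c * bernoulliMean p S φ := by
  simp only [bernoulliMean, Finset.mul_sum]
  exact Finset.sum_congr rfl fun _ _ => by ring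

theorem bernoulliMean_sum {β : Type*} (R : Finset β) (φ : β → Finset ι → ℝ) :
    bernoulliMean p S (fun T => ∑ k ∈ R, φ k T) = ∑ k ∈ R, bernoulliMean p S (φ k) := by
  simp only [bernoulliMean, Finset.mul_sum]
  exact Finset.sum_comm

theorem bernoulliProb_nonneg (hp : ∀ i, p i ∈ Set.Icc (0 : ℝ) 1) (A : Set (Finset ι)) :
    0 ≤ bernoulliProb p S A :=
  Finset.sum_nonneg fun T _ => mul_nonneg (bernoulliWeight_nonneg hp T)
    (Set.indicator_nonneg (fun _ _ => zero_le_one) T)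

theorem bernoulliProb_mono (hp : ∀ i, p i ∈ Set.Icc (0 : ℝ) 1) {A B : Set (Finset ι)}
    (h : A ⊆ B) : bernoulliProb p S A ≤ bernoulliProb p S B :=
  bernoulliMean_mono hp fun T _ =>
    Set.indicator_le_indicator_of_subset h (fun _ => zero_le_one) T

/-- The expectation is computed by conditioning on the membership of one element. -/
theorem bernoulliMean_insert {a : ι} (ha : a ∉ S) (φ : Finset ι → ℝ) :
    bernoulliMean p (insert a S) φ =
      (1 - p a) * bernoulliMean p S φ + p a * bernoulliMean p S (fun T => φ (insert a T)) := by
  rw [bernoulliMean, Finset.sum_powerset_insert ha, ← bernoulliMean_const_mul,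
    ← bernoulliMean_const_mul]
  congr 1
  · refine Finset.sum_congr rfl fun T hT => ?_
    have haT : a ∉ T := fun h => ha (Finset.mem_powerset.1 hT h)
    rw [bernoulliWeight, bernoulliWeight, Finset.insert_sdiff_of_notMem _ haT,
      Finset.prod_insert (by simp [ha])]
    ring
  · refine Finset.sum_congr rfl fun T hT => ?_
    have haT : a ∉ T := fun h => ha (Finset.mem_powerset.1 hT h)
    have h : insert a S \ insert a T = S \ T := by
      ext i
      simp only [Finset.mem_sdiff, Finset.mem_insert]
      grind
    rw [bernoulliWeight, bernoulliWeight, h, Finset.prod_insert haT]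
    ring

/-- Products of functions of the separate memberships have product expectation. -/
theorem bernoulliMean_prod (f g : ι → ℝ) :
    bernoulliMean p S (fun T => (∏ i ∈ T, f i) * ∏ i ∈ S \ T, g i) =
      ∏ i ∈ S, (p i * f i + (1 - p i) * g i) := by
  rw [Finset.prod_add, bernoulliMean]
  refine Finset.sum_congr rfl fun T _ => ?_
  rw [bernoulliWeight, Finset.prod_mul_distrib, Finset.prod_mul_distrib]
  ring

end Bernoulli

/-! ### Talagrand's convex distance inequality -/

/-- The square of Talagrand's convex distance from the set `T` to the family `A` is at most `h`,
where only elements of `T` that are missing in the approximating member of `A` count. The distance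
is encoded in dual form: a vector `v` with `∑ v i ^ 2 ≤ h` such that every nonnegative weight `w`
admits a member `U` of `A` whose defect `∑_{i ∈ T \ U} w i` is at most `⟪w, v⟫`. -/
def ConvexDistSqLE {ι : Type*} [DecidableEq ι] (A : Set (Finset ι)) (T : Finset ι) (h : ℝ) :
    Prop :=
  ∃ v : ι → ℝ, ∑ i ∈ T, v i ^ 2 ≤ h ∧
    ∀ w : ι → ℝ, (∀ i, 0 ≤ w i) → ∃ U ∈ A, ∑ i ∈ T \ U, w i ≤ ∑ i ∈ T, w i * v i

section ConvexDistance

variable {ι : Type*} [DecidableEq ι] {p : ι → ℝ} {S : Finset ι} {A : Set (Finset ι)}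
  {T : Finset ι} {a : ι}

/-- Adding `a` to an approximating set only decreases its defect. -/
theorem ConvexDistSqLE.of_insert {h : ℝ}
    (hT : ConvexDistSqLE {U | U ∈ A ∨ insert a U ∈ A} T h) : ConvexDistSqLE A T h := by
  obtain ⟨v, hv, H⟩ := hT
  refine ⟨v, hv, fun w hw => ?_⟩
  obtain ⟨U, hU | hU, hle⟩ := H w hw
  · exact ⟨U, hU, hle⟩
  · refine ⟨insert a U, hU, le_trans (Finset.sum_le_sum_of_subset_of_nonneg ?_ fun i _ _ => hw i)
      hle⟩
    exact Finset.sdiff_subset_sdiff subset_rfl (Finset.subset_insert _ _)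

/-- Convex combination of an approximation that agrees at the element `a` with one that is allowed
to miss it. -/
theorem ConvexDistSqLE.insert_mix {h₁ h₀ l : ℝ} (ha : a ∉ T) (hl : l ∈ Set.Icc (0 : ℝ) 1)
    (h1 : ConvexDistSqLE {U | insert a U ∈ A} T h₁)
    (h0 : ConvexDistSqLE {U | U ∈ A ∨ insert a U ∈ A} T h₀) :
    ConvexDistSqLE A (insert a T) (l * h₁ + (1 - l) * h₀ + (1 - l) ^ 2) := by
  obtain ⟨v₁, hv₁, H₁⟩ := h1
  obtain ⟨v₀, hv₀, H₀⟩ := h0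
  obtain ⟨hl0, hl1⟩ := hl
  have key : ∀ f : ι → ℝ → ℝ,
      ∑ i ∈ T, f i (if i = a then 1 - l else l * v₁ i + (1 - l) * v₀ i) =
        ∑ i ∈ T, f i (l * v₁ i + (1 - l) * v₀ i) := fun f =>
    Finset.sum_congr rfl fun i hi => by
      rw [if_neg]
      rintro rfl
      exact ha hi
  refine ⟨fun i => if i = a then 1 - l else l * v₁ i + (1 - l) * v₀ i, ?_, fun w hw => ?_⟩
  · rw [Finset.sum_insert ha, key fun _ x => x ^ 2]
    simp only [if_true]
    have : ∑ i ∈ T, (l * v₁ i + (1 - l) * v₀ i) ^ 2 ≤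
        l * ∑ i ∈ T, v₁ i ^ 2 + (1 - l) * ∑ i ∈ T, v₀ i ^ 2 := by
      rw [Finset.mul_sum, Finset.mul_sum, ← Finset.sum_add_distrib]
      refine Finset.sum_le_sum fun i _ => ?_
      nlinarith [mul_nonneg (mul_nonneg hl0 (sub_nonneg.2 hl1)) (sq_nonneg (v₁ i - v₀ i))]
    have e1 := mul_le_mul_of_nonneg_left hv₁ hl0
    have e0 := mul_le_mul_of_nonneg_left hv₀ (sub_nonneg.2 hl1)
    linarith
  · obtain ⟨U₁, hU₁, hle₁⟩ := H₁ w hw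
    obtain ⟨U₀, hU₀, hle₀⟩ := H₀ w hw
    rw [Finset.sum_insert ha, key fun i x => w i * x]
    simp only [if_true]
    have hsum : ∑ i ∈ T, w i * (l * v₁ i + (1 - l) * v₀ i) =
        l * ∑ i ∈ T, w i * v₁ i + (1 - l) * ∑ i ∈ T, w i * v₀ i := by
      rw [Finset.mul_sum, Finset.mul_sum, ← Finset.sum_add_distrib]
      exact Finset.sum_congr rfl fun i _ => by ring
    have hd₁ : ∑ i ∈ insert a T \ insert a U₁, w i ≤ ∑ i ∈ T \ U₁, w i :=
      Finset.sum_le_sum_of_subset_of_nonneg (fun i => by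
        simp only [Finset.mem_sdiff, Finset.mem_insert]; grind) fun i _ _ => hw i
    have hd₀ : ∑ i ∈ insert a T \ U₀, w i ≤ w a + ∑ i ∈ T \ U₀, w i := by
      rw [← Finset.sum_insert (by simp [ha])]
      exact Finset.sum_le_sum_of_subset_of_nonneg (fun i => by
        simp only [Finset.mem_sdiff, Finset.mem_insert]; grind) fun i _ _ => hw i
    have hd₀' : ∑ i ∈ insert a T \ insert a U₀, w i ≤ ∑ i ∈ insert a T \ U₀, w i :=
      Finset.sum_le_sum_of_subset_of_nonneg
        (Finset.sdiff_subset_sdiff subset_rfl (Finset.subset_insert _ _)) fun i _ _ => hw i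
    rw [hsum]
    -- The smaller of the two defects is at most their convex combination.
    by_cases hc : ∑ i ∈ T, w i * v₁ i ≤ w a + ∑ i ∈ T, w i * v₀ i
    · exact ⟨_, hU₁, by nlinarith⟩
    · push Not at hc
      rcases hU₀ with hU₀ | hU₀
      · exact ⟨_, hU₀, by nlinarith⟩
      · exact ⟨_, hU₀, by nlinarith⟩

/-- The case of `ConvexDistSqLE.insert_mix` with mixing parameter `0`, which needs no approximation
that agrees at `a`. -/
theorem ConvexDistSqLE.insert_miss {h₀ : ℝ} (ha : a ∉ T)
    (h0 : ConvexDistSqLE {U | U ∈ A ∨ insert a U ∈ A} T h₀) :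
    ConvexDistSqLE A (insert a T) (h₀ + 1) := by
  obtain ⟨v, hv, H⟩ := h0
  have key : ∀ f : ι → ℝ → ℝ,
      ∑ i ∈ T, f i (if i = a then 1 else v i) = ∑ i ∈ T, f i (v i) := fun f =>
    Finset.sum_congr rfl fun i hi => by
      rw [if_neg]
      rintro rfl
      exact ha hi
  refine ⟨fun i => if i = a then 1 else v i, ?_, fun w hw => ?_⟩
  · rw [Finset.sum_insert ha, key fun _ x => x ^ 2]
    simp only [if_true]
    linarith
  · obtain ⟨U, hU, hle⟩ := H w hw
    rw [Finset.sum_insert ha, key fun i x => w i * x]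
    simp only [if_true]
    have hd : ∑ i ∈ insert a T \ U, w i ≤ w a + ∑ i ∈ T \ U, w i := by
      rw [← Finset.sum_insert (by simp [ha])]
      exact Finset.sum_le_sum_of_subset_of_nonneg (fun i => by
        simp only [Finset.mem_sdiff, Finset.mem_insert]; grind) fun i _ _ => hw i
    have hd' : ∑ i ∈ insert a T \ insert a U, w i ≤ ∑ i ∈ insert a T \ U, w i :=
      Finset.sum_le_sum_of_subset_of_nonneg
        (Finset.sdiff_subset_sdiff subset_rfl (Finset.subset_insert _ _)) fun i _ _ => hw i
    rcases hU with hU | hU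
    · exact ⟨_, hU, by linarith⟩
    · exact ⟨_, hU, by linarith⟩

theorem Real.exp_neg_le_quadratic {s : ℝ} (hs : 0 ≤ s) : Real.exp (-s) ≤ 1 - s + s ^ 2 / 2 := by
  have h := Real.quadratic_le_exp_of_nonneg hs
  have hpos : 0 < 1 - s + s ^ 2 / 2 := by nlinarith [sq_nonneg (s - 1)]
  rw [Real.exp_neg, inv_le_comm₀ (Real.exp_pos s) hpos]
  refine le_trans ?_ h
  rw [inv_le_iff_one_le_mul₀ hpos]
  nlinarith [sq_nonneg (s ^ 2)]

theorem Real.exp_le_cubic {y : ℝ} (h0 : 0 ≤ y) (h1 : y ≤ 1) :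
    Real.exp y ≤ 1 + y + y ^ 2 / 2 + 2 / 9 * y ^ 3 := by
  have h := Real.exp_bound' h0 h1 (n := 3) (by norm_num)
  norm_num [Finset.sum_range_succ, Nat.factorial] at h
  linarith

/-- The optimisation over the mixing parameter in the convex distance inequality, when the mixing
parameter `1 - 2 s` is admissible. -/
theorem exp_sub_sq_le {s : ℝ} (h0 : 0 ≤ s) (h1 : s ≤ 1 / 2) :
    Real.exp (s - s ^ 2) ≤ 2 - Real.exp (-s) := by
  have e1 := Real.exp_neg_le_quadratic h0
  have e2 := Real.exp_le_cubic (y := s - s ^ 2) (by nlinarith) (by nlinarith)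
  have h3 : 0 ≤ s ^ 3 := by positivity
  have h4 : (1 - s) ^ 3 ≤ 1 := pow_le_one₀ (by linarith) (by linarith)
  have h5 : s ^ 3 * (-1 + s / 2 + 2 / 9 * (1 - s) ^ 3) ≤ 0 :=
    mul_nonpos_of_nonneg_of_nonpos h3 (by linarith)
  nlinarith

/-- The optimisation over the mixing parameter in the convex distance inequality, for mixing
parameter `0`. -/
theorem exp_quarter_le {r : ℝ} (hr : r ≤ Real.exp (-(1 / 2))) : Real.exp (1 / 4) ≤ 2 - r := by
  have e1 := Real.exp_neg_le_quadratic (s := 1 / 2) (by norm_num)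
  have e2 := Real.exp_le_cubic (y := 1 / 4) (by norm_num) (by norm_num)
  linarith

/-- Hölder's inequality in the form used for mixing two convex distances. -/
theorem bernoulliMean_exp_mix_le (hp : ∀ i, p i ∈ Set.Icc (0 : ℝ) 1) {h₁ h₀ : Finset ι → ℝ}
    {q₁ q₀ l : ℝ} (hl : l ∈ Set.Icc (0 : ℝ) 1) (hq₁ : 0 < q₁) (hq₀ : 0 < q₀)
    (H₁ : bernoulliMean p S (fun T => Real.exp (h₁ T / 4)) ≤ q₁⁻¹)
    (H₀ : bernoulliMean p S (fun T => Real.exp (h₀ T / 4)) ≤ q₀⁻¹) :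
    bernoulliMean p S (fun T => Real.exp ((l * h₁ T + (1 - l) * h₀ T + (1 - l) ^ 2) / 4)) ≤
      Real.exp ((1 - l) ^ 2 / 4 - l * Real.log (q₁ / q₀)) * q₀⁻¹ := by
  obtain ⟨hl0, hl1⟩ := hl
  set c := Real.exp ((1 - l) ^ 2 / 4 - l * Real.log (q₁ / q₀)) * q₀⁻¹ with hc
  have hcpos : 0 < c := by positivity
  have hcexp : c = Real.exp ((1 - l) ^ 2 / 4 - (l * Real.log q₁ + (1 - l) * Real.log q₀)) := by
    rw [hc, ← Real.exp_log hq₀, ← Real.exp_neg, ← Real.exp_add, Real.exp_log hq₀,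
      Real.log_div hq₁.ne' hq₀.ne']
    congr 1
    ring
  have hpt : ∀ T ⊆ S, Real.exp ((l * h₁ T + (1 - l) * h₀ T + (1 - l) ^ 2) / 4) ≤
      (c * (l * q₁)) * Real.exp (h₁ T / 4) + (c * ((1 - l) * q₀)) * Real.exp (h₀ T / 4) := by
    intro T _
    have hconv := convexOn_exp.2 (Set.mem_univ (h₁ T / 4 + Real.log q₁))
      (Set.mem_univ (h₀ T / 4 + Real.log q₀)) hl0 (sub_nonneg.2 hl1) (by ring)
    simp only [smul_eq_mul, Real.exp_add (h₁ T / 4), Real.exp_add (h₀ T / 4), Real.exp_log hq₁,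
      Real.exp_log hq₀] at hconv
    have hmul := mul_le_mul_of_nonneg_left hconv hcpos.le
    rw [hcexp, ← Real.exp_add, ← hcexp] at hmul
    refine le_trans (le_of_eq ?_) (hmul.trans (le_of_eq ?_))
    · congr 1
      ring
    · ring
  refine (bernoulliMean_mono hp hpt).trans ?_
  rw [bernoulliMean_add, bernoulliMean_const_mul, bernoulliMean_const_mul]
  have e1 := mul_le_mul_of_nonneg_left H₁ (mul_nonneg hcpos.le (mul_nonneg hl0 hq₁.le))
  have e0 := mul_le_mul_of_nonneg_left H₀ (mul_nonneg hcpos.le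
    (mul_nonneg (sub_nonneg.2 hl1) hq₀.le))
  have f1 : c * (l * q₁) * q₁⁻¹ = c * l := by field_simp
  have f0 : c * ((1 - l) * q₀) * q₀⁻¹ = c * (1 - l) := by field_simp
  rw [f1] at e1
  rw [f0] at e0
  linarith

/-- Talagrand's convex distance inequality for the random subset of `S`: the squared convex
distance `h` to a family `A` of positive probability satisfies `𝔼 exp (h / 4) ≤ 1 / ℙ(A)`. -/
theorem exists_convexDistSqLE (hp : ∀ i, p i ∈ Set.Icc (0 : ℝ) 1) (S : Finset ι) :
    ∀ A : Set (Finset ι), 0 < bernoulliProb p S A →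
      ∃ h : Finset ι → ℝ, bernoulliMean p S (fun T => Real.exp (h T / 4)) ≤ (bernoulliProb p S A)⁻¹ ∧
        ∀ T ⊆ S, ConvexDistSqLE A T (h T) := by
  induction S using Finset.induction_on with
  | empty =>
    intro A hA
    have hmem : ∅ ∈ A := by
      by_contra h
      simp [bernoulliProb, bernoulliMean, h] at hA
    refine ⟨0, by simp [bernoulliProb, bernoulliMean, bernoulliWeight, hmem], fun T hT => ?_⟩
    obtain rfl := Finset.subset_empty.1 hT
    exact ⟨0, by simp, fun w _ => ⟨∅, hmem, by simp⟩⟩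
  | insert a S ha ih =>
    intro A hA
    set A₁ : Set (Finset ι) := {U | insert a U ∈ A} with hA₁
    set A₀ : Set (Finset ι) := {U | U ∈ A ∨ insert a U ∈ A} with hA₀
    have hpa := hp a
    have hins : bernoulliProb p (insert a S) A =
        (1 - p a) * bernoulliProb p S A + p a * bernoulliProb p S A₁ :=
      bernoulliMean_insert ha _
    have hle : bernoulliProb p S A ≤ bernoulliProb p S A₀ :=
      bernoulliProb_mono hp fun U hU => Or.inl hU
    have hle₁ : bernoulliProb p S A₁ ≤ bernoulliProb p S A₀ :=
      bernoulliProb_mono hp fun U hU => Or.inr hU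
    have hnn₁ : 0 ≤ bernoulliProb p S A₁ := bernoulliProb_nonneg hp A₁
    have h0pos : 0 < bernoulliProb p S A₀ := by
      by_contra hneg
      nlinarith [hpa.1, hpa.2, bernoulliProb_nonneg (S := S) hp A]
    obtain ⟨h₀, hm₀, hd₀⟩ := ih A₀ h0pos
    set q₀ := bernoulliProb p S A₀
    set q₁ := bernoulliProb p S A₁
    set r := q₁ / q₀ with hr
    have hr0 : 0 ≤ r := by positivity
    have hr1 : r ≤ 1 := div_le_one_of_le₀ hle₁ h0pos.le
    have hmain : ∃ g : Finset ι → ℝ,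
        bernoulliMean p S (fun T => Real.exp (g T / 4)) ≤ (2 - r) * q₀⁻¹ ∧
          ∀ T ⊆ S, ConvexDistSqLE A (insert a T) (g T) := by
      by_cases hcase : r ≤ Real.exp (-(1 / 2))
      · refine ⟨fun T => h₀ T + 1, ?_, fun T hT =>
          (hd₀ T hT).insert_miss fun h => ha (hT h)⟩
        have : (fun T => Real.exp ((h₀ T + 1) / 4)) =
            fun T => Real.exp (1 / 4) * Real.exp (h₀ T / 4) := by
          ext T
          rw [← Real.exp_add]
          congr 1
          ring
        rw [this, bernoulliMean_const_mul]
        exact mul_le_mul (exp_quarter_le hcase) hm₀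
          (Finset.sum_nonneg fun T _ => mul_nonneg (bernoulliWeight_nonneg hp T)
            (Real.exp_pos _).le) (by linarith)
      · push Not at hcase
        have hrpos : 0 < r := (Real.exp_pos _).trans hcase
        have h1pos : 0 < q₁ := by
          rcases hnn₁.eq_or_lt with h | h
          · rw [hr, ← h, zero_div] at hrpos
            exact absurd hrpos (lt_irrefl _)
          · exact h
        obtain ⟨h₁, hm₁, hd₁⟩ := ih A₁ h1pos
        set s := -Real.log r with hs
        have hs0 : 0 ≤ s := neg_nonneg.2 (Real.log_nonpos hr0 hr1)
        have hs1 : s ≤ 1 / 2 := by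
          have := (Real.lt_log_iff_exp_lt hrpos).2 hcase
          linarith
        have hl : 1 - 2 * s ∈ Set.Icc (0 : ℝ) 1 := ⟨by linarith, by linarith⟩
        refine ⟨_, ?_, fun T hT =>
          (hd₁ T hT).insert_mix (fun h => ha (hT h)) hl (hd₀ T hT)⟩
        refine (bernoulliMean_exp_mix_le hp hl h1pos h0pos hm₁ hm₀).trans
          (mul_le_mul_of_nonneg_right ?_ (inv_nonneg.2 h0pos.le))
        have e := exp_sub_sq_le hs0 hs1
        have hexp : Real.exp (-s) = r := by rw [hs, neg_neg, Real.exp_log hrpos]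
        rw [hexp] at e
        refine le_trans (le_of_eq ?_) e
        congr 1
        rw [← hr, show Real.log r = -s by rw [hs, neg_neg]]
        ring
    obtain ⟨g, hmg, hdg⟩ := hmain
    refine ⟨fun T => if a ∈ T then g (T.erase a) else h₀ T, ?_, fun T hT => ?_⟩
    · have hmean : bernoulliMean p (insert a S)
          (fun T => Real.exp ((if a ∈ T then g (T.erase a) else h₀ T) / 4)) =
          (1 - p a) * bernoulliMean p S (fun T => Real.exp (h₀ T / 4)) +
            p a * bernoulliMean p S (fun T => Real.exp (g T / 4)) := by
        rw [bernoulliMean_insert ha]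
        congr 2
        · refine Finset.sum_congr rfl fun T hT => ?_
          dsimp only
          rw [if_neg fun h => ha (Finset.mem_powerset.1 hT h)]
        · refine Finset.sum_congr rfl fun T hT => ?_
          dsimp only
          rw [if_pos (Finset.mem_insert_self a T),
            Finset.erase_insert fun h => ha (Finset.mem_powerset.1 hT h)]
      rw [hmean, hins]
      rw [hins] at hA
      rw [← one_div, le_div_iff₀ hA]
      have hq₁ : q₁ = r * q₀ := by rw [hr, div_mul_cancel₀ _ h0pos.ne']
      -- `1 - p + p (2 - r) = 1 + p (1 - r)` and `1 - p + p r = 1 - p (1 - r)`.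
      calc _ ≤ ((1 + p a * (1 - r)) * q₀⁻¹) * ((1 - p a * (1 - r)) * q₀) := by
            refine mul_le_mul ?_ ?_ hA.le ?_
            · have e0 := mul_le_mul_of_nonneg_left hm₀ (sub_nonneg.2 hpa.2)
              have e1 := mul_le_mul_of_nonneg_left hmg hpa.1
              linarith
            · have e0 := mul_le_mul_of_nonneg_left hle (sub_nonneg.2 hpa.2)
              rw [hq₁]
              linarith
            · have := mul_nonneg hpa.1 (sub_nonneg.2 hr1)
              positivity
        _ = 1 - (p a * (1 - r)) ^ 2 := by
            field_simp
            ring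
        _ ≤ 1 := by linarith [sq_nonneg (p a * (1 - r))]
    · by_cases haT : a ∈ T
      · have hsub : T.erase a ⊆ S := fun i hi => by
          have := hT (Finset.mem_of_mem_erase hi)
          exact (Finset.mem_insert.1 this).resolve_left (Finset.ne_of_mem_erase hi)
        have := hdg _ hsub
        rw [Finset.insert_erase haT] at this
        simpa [haT] using this
      · have hsub : T ⊆ S := fun i hi =>
          (Finset.mem_insert.1 (hT hi)).resolve_left fun h => haT (h ▸ hi)
        simpa [haT] using (hd₀ T hsub).of_insert

end ConvexDistance

/-! ### Sums over pairs of a random subset -/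

/-- The sum of the symmetric kernel `g` over the unordered pairs of distinct elements of `T`. -/
noncomputable def pairSum {ι : Type*} [DecidableEq ι] (g : ι → ι → ℝ) (T : Finset ι) : ℝ :=
  (1 / 2) * ∑ x ∈ T.offDiag, g x.1 x.2

/-- The contribution to `pairSum g T` of the pairs that contain `i`. -/
def localSum {ι : Type*} [DecidableEq ι] (g : ι → ι → ℝ) (T : Finset ι) (i : ι) : ℝ :=
  ∑ j ∈ T.erase i, g i j

section PairSum

variable {ι : Type*} [DecidableEq ι] {p : ι → ℝ} {S T U : Finset ι} {g : ι → ι → ℝ}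

theorem localSum_nonneg (hg : ∀ i j, 0 ≤ g i j) (T : Finset ι) (i : ι) : 0 ≤ localSum g T i :=
  Finset.sum_nonneg fun _ _ => hg _ _

theorem localSum_eq_sum_ite (g : ι → ι → ℝ) (T : Finset ι) (i : ι) :
    localSum g T i = ∑ j ∈ T, if i ≠ j then g i j else 0 := by
  rw [localSum, ← Finset.sum_filter]
  exact Finset.sum_congr (by ext j; simp [and_comm, eq_comm]) fun _ _ => rfl

theorem sum_offDiag_eq_sum_ite (g : ι → ι → ℝ) (T : Finset ι) :
    ∑ x ∈ T.offDiag, g x.1 x.2 = ∑ i ∈ T, ∑ j ∈ T, if i ≠ j then g i j else 0 := by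
  rw [← Finset.sum_product', ← Finset.sum_filter]
  exact Finset.sum_congr (by ext x; simp [and_assoc]) fun _ _ => rfl

theorem sum_localSum (g : ι → ι → ℝ) (T : Finset ι) :
    ∑ i ∈ T, localSum g T i = 2 * pairSum g T := by
  simp only [pairSum, sum_offDiag_eq_sum_ite, localSum_eq_sum_ite]
  ring

/-- Removing points decreases the pair sum by at most their contributions. -/
theorem pairSum_le_add (hg : ∀ i j, 0 ≤ g i j) (hsymm : ∀ i j, g i j = g j i) :
    pairSum g T ≤ pairSum g U + ∑ i ∈ T \ U, localSum g T i := by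
  set G : ι → ι → ℝ := fun i j => if i ≠ j then g i j else 0 with hG
  have hG0 : ∀ i j, 0 ≤ G i j := fun i j => by
    simp only [hG]
    split_ifs
    exacts [hg i j, le_rfl]
  have hGs : ∀ i j, G i j = G j i := fun i j => by simp only [hG, hsymm i j, ne_comm]
  have h1 : ∑ i ∈ T, ∑ j ∈ T, (if i ∈ U ∧ j ∈ U then G i j else 0) ≤
      ∑ x ∈ U.offDiag, g x.1 x.2 := by
    rw [sum_offDiag_eq_sum_ite, ← Finset.sum_product', ← Finset.sum_product', ← Finset.sum_filter]
    exact Finset.sum_le_sum_of_subset_of_nonneg (fun x => by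
      simp only [Finset.mem_filter, Finset.mem_product]; tauto) fun x _ _ => hG0 _ _
  have h2 : ∑ i ∈ T \ U, localSum g T i = ∑ i ∈ T, ∑ j ∈ T, if i ∉ U then G i j else 0 := by
    rw [← Finset.filter_notMem_eq_sdiff, Finset.sum_filter]
    refine Finset.sum_congr rfl fun i _ => ?_
    split_ifs
    · simp
    · rw [localSum_eq_sum_ite]
  have h3 : ∑ i ∈ T \ U, localSum g T i = ∑ i ∈ T, ∑ j ∈ T, if j ∉ U then G i j else 0 := by
    rw [h2, Finset.sum_comm]
    simp only [hGs]
  have h4 : ∑ x ∈ T.offDiag, g x.1 x.2 ≤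
      ∑ i ∈ T, ∑ j ∈ T, (if i ∈ U ∧ j ∈ U then G i j else 0) +
      ∑ i ∈ T, ∑ j ∈ T, (if i ∉ U then G i j else 0) +
      ∑ i ∈ T, ∑ j ∈ T, (if j ∉ U then G i j else 0) := by
    simp only [← Finset.sum_add_distrib]
    rw [sum_offDiag_eq_sum_ite]
    refine Finset.sum_le_sum fun i _ => Finset.sum_le_sum fun j _ => ?_
    have := hG0 i j
    change G i j ≤ _
    by_cases hi : i ∈ U <;> by_cases hj : j ∈ U <;> simp [hi, hj, this]
  simp only [pairSum]
  linarith

/-- A set whose pair sum is at least `b` and whose points contribute at most `M` each has a large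
convex distance to every family of sets with pair sum at most `a`. -/
theorem ConvexDistSqLE.le_of_pairSum {a b M h : ℝ} {A : Set (Finset ι)}
    (hg : ∀ i j, 0 ≤ g i j) (hsymm : ∀ i j, g i j = g j i) (ha : 0 ≤ a) (hab : a < b)
    (hM : 0 < M) (hA : ∀ U ∈ A, pairSum g U ≤ a) (hb : b ≤ pairSum g T)
    (hloc : ∀ i ∈ T, localSum g T i ≤ M) (hd : ConvexDistSqLE A T h) :
    (b - a) ^ 2 / (2 * b * M) ≤ h := by
  obtain ⟨v, hv, H⟩ := hd
  obtain ⟨U, hU, hle⟩ := H (localSum g T) (localSum_nonneg hg T)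
  set f := pairSum g T
  have hb0 : 0 < b := ha.trans_lt hab
  have h1 : f - a ≤ ∑ i ∈ T, localSum g T i * v i := by
    have := pairSum_le_add (T := T) (U := U) hg hsymm
    have := hA U hU
    linarith
  have h2 : ∑ i ∈ T, localSum g T i ^ 2 ≤ M * (2 * f) := by
    rw [← sum_localSum, Finset.mul_sum]
    refine Finset.sum_le_sum fun i hi => ?_
    rw [sq]
    exact mul_le_mul_of_nonneg_right (hloc i hi) (localSum_nonneg hg T i)
  have h3 : (f - a) ^ 2 ≤ M * (2 * f) * h := by
    have hcs := Finset.sum_mul_sq_le_sq_mul_sq T (localSum g T) v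
    have hsq : (f - a) ^ 2 ≤ (∑ i ∈ T, localSum g T i * v i) ^ 2 :=
      pow_le_pow_left₀ (by linarith) h1 2
    refine hsq.trans (hcs.trans (mul_le_mul h2 hv (Finset.sum_nonneg fun _ _ => sq_nonneg _) ?_))
    have : 0 ≤ f := by linarith
    positivity
  have hf0 : 0 < f := hb0.trans_le hb
  -- `(f - a) ^ 2 / f` is increasing in `f ≥ a`.
  have h4 : (b - a) ^ 2 * f ≤ (f - a) ^ 2 * b := by
    nlinarith [mul_nonneg (sub_nonneg.2 hb) (show 0 ≤ b * f - a ^ 2 by nlinarith)]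
  rw [div_le_iff₀ (by positivity)]
  have h5 := mul_le_mul_of_nonneg_right h3 hb0.le
  have h6 : (b - a) ^ 2 * f ≤ h * (2 * b * M) * f := by linarith
  exact le_of_mul_le_mul_right h6 hf0

/-- The two-level inequality on the event that every point contributes at most `M`. -/
theorem bernoulliProb_pairSum_mul_le {a b M : ℝ} (hp : ∀ i, p i ∈ Set.Icc (0 : ℝ) 1)
    (hg : ∀ i j, 0 ≤ g i j) (hsymm : ∀ i j, g i j = g j i) (ha : 0 ≤ a) (hab : a < b)
    (hM : 0 < M) :
    bernoulliProb p S {T | pairSum g T ≤ a} *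
      bernoulliProb p S {T | b ≤ pairSum g T ∧ ∀ i ∈ T, localSum g T i ≤ M} ≤
        Real.exp (-((b - a) ^ 2 / (8 * b * M))) := by
  rcases (bernoulliProb_nonneg (S := S) hp {T | pairSum g T ≤ a}).eq_or_lt with h0 | hpos
  · rw [← h0, zero_mul]
    positivity
  obtain ⟨h, hm, hd⟩ := exists_convexDistSqLE hp S _ hpos
  set B : Set (Finset ι) := {T | b ≤ pairSum g T ∧ ∀ i ∈ T, localSum g T i ≤ M}
  have h1 : Real.exp ((b - a) ^ 2 / (8 * b * M)) * bernoulliProb p S B ≤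
      bernoulliMean p S (fun T => Real.exp (h T / 4)) := by
    rw [bernoulliProb, ← bernoulliMean_const_mul]
    refine bernoulliMean_mono hp fun T hT => ?_
    by_cases hB : T ∈ B
    · rw [Set.indicator_of_mem hB, Pi.one_apply, mul_one, Real.exp_le_exp]
      have := (hd T hT).le_of_pairSum hg hsymm ha hab hM (fun U hU => hU) hB.1 hB.2
      have e : (b - a) ^ 2 / (8 * b * M) = (b - a) ^ 2 / (2 * b * M) / 4 := by
        rw [div_div]
        congr 1
        ring
      rw [e]
      linarith
    · rw [Set.indicator_of_notMem hB, mul_zero]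
      positivity
  have h2 := h1.trans hm
  rw [← one_div, le_div_iff₀ hpos] at h2
  rw [Real.exp_neg, ← one_div, le_div_iff₀ (Real.exp_pos _)]
  linarith

/-- The exponential moment of the degree of `i`, on the event that `i` is present, is that of a
Poisson variable at most. -/
theorem bernoulliMean_exp_degree_le {s : ℝ} (hp : ∀ i, p i ∈ Set.Icc (0 : ℝ) 1)
    (adj : ι → ι → Prop) [DecidableRel adj] {i : ι} (hi : i ∈ S) :
    bernoulliMean p S
        (fun T => if i ∈ T then Real.exp (s * ((T.erase i).filter (adj i)).card) else 0) ≤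
      p i * Real.exp ((Real.exp s - 1) * ∑ j ∈ (S.erase i).filter (adj i), p j) := by
  set f : ι → ℝ := fun j => if j ≠ i ∧ adj i j then Real.exp s else 1 with hf
  set e : ι → ℝ := fun j => if j = i then 0 else 1 with he
  have h1 : bernoulliMean p S
        (fun T => if i ∈ T then Real.exp (s * ((T.erase i).filter (adj i)).card) else 0) =
      bernoulliMean p S (fun T => (∏ j ∈ T, f j) * ∏ j ∈ S \ T, e j) := by
    refine Finset.sum_congr rfl fun T _ => ?_
    congr 1
    have hpf : ∏ j ∈ T, f j = Real.exp (s * ((T.erase i).filter (adj i)).card) := by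
      rw [hf, ← Finset.prod_filter, Finset.prod_const, ← Real.exp_nat_mul, mul_comm]
      congr 4
      ext j
      simp only [Finset.mem_filter, Finset.mem_erase]
      tauto
    dsimp only
    rw [hpf]
    split_ifs with hiT
    · rw [Finset.prod_eq_one, mul_one]
      intro j hj
      rw [he]
      dsimp only
      rw [if_neg]
      rintro rfl
      exact (Finset.mem_sdiff.1 hj).2 hiT
    · rw [Finset.prod_eq_zero (Finset.mem_sdiff.2 ⟨hi, hiT⟩) (by simp [he]), mul_zero]
  rw [h1, bernoulliMean_prod, ← Finset.mul_prod_erase S _ hi]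
  have hpi : p i * f i + (1 - p i) * e i = p i := by simp [hf, he]
  rw [hpi]
  refine mul_le_mul_of_nonneg_left ?_ (hp i).1
  rw [Finset.mul_sum, Finset.sum_filter, Real.exp_sum]
  refine Finset.prod_le_prod (fun j _ => ?_) fun j hj => ?_
  · have hfj : 0 ≤ f j := by
      simp only [hf]
      split_ifs <;> positivity
    have hej : 0 ≤ e j := by
      simp only [he]
      split_ifs <;> norm_num
    exact add_nonneg (mul_nonneg (hp j).1 hfj) (mul_nonneg (sub_nonneg.2 (hp j).2) hej)
  · have hji := Finset.ne_of_mem_erase hj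
    simp only [hf, he, hji, ne_eq, not_false_eq_true, true_and, if_false]
    split_ifs
    · have := Real.add_one_le_exp ((Real.exp s - 1) * p j)
      linarith
    · simp

/-- Chernoff's bound, summed over the points, for the maximal degree of the random graph induced by
a relation on the random subset of `S`. -/
theorem bernoulliProb_degree_le {s D : ℝ} (hs : 0 ≤ s) (hp : ∀ i, p i ∈ Set.Icc (0 : ℝ) 1)
    (adj : ι → ι → Prop) [DecidableRel adj] :
    bernoulliProb p S {T | ∃ i ∈ T, D < ((T.erase i).filter (adj i)).card} ≤
      ∑ i ∈ S, p i *
        Real.exp ((Real.exp s - 1) * ∑ j ∈ (S.erase i).filter (adj i), p j - s * D) := by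
  have h1 : bernoulliProb p S {T | ∃ i ∈ T, D < ((T.erase i).filter (adj i)).card} ≤
      bernoulliMean p S (fun T => ∑ i ∈ S, Real.exp (-(s * D)) *
        if i ∈ T then Real.exp (s * ((T.erase i).filter (adj i)).card) else 0) := by
    refine bernoulliMean_mono hp fun T hT => ?_
    have hnn : ∀ i ∈ S, 0 ≤ Real.exp (-(s * D)) *
        if i ∈ T then Real.exp (s * ((T.erase i).filter (adj i)).card) else 0 := fun i _ => by
      split_ifs <;> positivity
    by_cases hmem : T ∈ {T : Finset ι | ∃ i ∈ T, D < ((T.erase i).filter (adj i)).card}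
    · rw [Set.indicator_of_mem hmem]
      obtain ⟨i, hi, hD⟩ := hmem
      refine le_trans ?_ (Finset.single_le_sum hnn (hT hi))
      rw [if_pos hi, ← Real.exp_add, Pi.one_apply]
      refine Real.one_le_exp ?_
      nlinarith
    · rw [Set.indicator_of_notMem hmem]
      exact Finset.sum_nonneg hnn
  refine h1.trans ?_
  rw [bernoulliMean_sum]
  refine Finset.sum_le_sum fun i hi => ?_
  rw [bernoulliMean_const_mul]
  refine (mul_le_mul_of_nonneg_left (bernoulliMean_exp_degree_le hp adj hi)
    (Real.exp_pos _).le).trans (le_of_eq ?_)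
  rw [mul_left_comm, ← Real.exp_add, neg_add_eq_sub]

/-- Concentration of pair sums with a kernel bounded by `c` on an adjacency relation: the convex
distance inequality, applied where all degrees are at most `D`. -/
theorem bernoulliProb_pairSum_mul_sub_le {a b c D s K q : ℝ} (hs : 0 ≤ s)
    (hp : ∀ i, p i ∈ Set.Icc (0 : ℝ) 1) (adj : ι → ι → Prop) [DecidableRel adj]
    (hg : ∀ i j, 0 ≤ g i j) (hsymm : ∀ i j, g i j = g j i)
    (hgc : ∀ i j, g i j ≤ if adj i j then c else 0) (ha : 0 ≤ a) (hab : a < b) (hc : 0 < c)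
    (hD : 0 < D) (hK : ∀ i ∈ S, ∑ j ∈ (S.erase i).filter (adj i), p j ≤ K)
    (hq : ∑ i ∈ S, p i ≤ q) :
    bernoulliProb p S {T | pairSum g T ≤ a} *
      (bernoulliProb p S {T | b ≤ pairSum g T} - q * Real.exp ((Real.exp s - 1) * K - s * D)) ≤
        Real.exp (-((b - a) ^ 2 / (8 * b * (c * D)))) := by
  refine le_trans (mul_le_mul_of_nonneg_left ?_ (bernoulliProb_nonneg hp _))
    (bernoulliProb_pairSum_mul_le hp hg hsymm ha hab (mul_pos hc hD))
  rw [sub_le_iff_le_add]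
  have hdeg : bernoulliProb p S {T | ∃ i ∈ T, D < ((T.erase i).filter (adj i)).card} ≤
      q * Real.exp ((Real.exp s - 1) * K - s * D) := by
    refine (bernoulliProb_degree_le hs hp adj).trans (le_trans ?_
      (mul_le_mul_of_nonneg_right hq (Real.exp_pos _).le))
    rw [Finset.sum_mul]
    refine Finset.sum_le_sum fun i hi => mul_le_mul_of_nonneg_left ?_ (hp i).1
    rw [Real.exp_le_exp]
    have := mul_le_mul_of_nonneg_left (hK i hi) (sub_nonneg.2 (Real.one_le_exp hs))
    linarith
  refine le_trans ?_ (add_le_add le_rfl hdeg)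
  simp only [bernoulliProb]
  rw [← bernoulliMean_add]
  refine bernoulliMean_mono hp fun T _ => ?_
  have hnn : ∀ A : Set (Finset ι), 0 ≤ A.indicator (1 : Finset ι → ℝ) T := fun A =>
    Set.indicator_nonneg (fun _ _ => zero_le_one) T
  by_cases hb : T ∈ {T | b ≤ pairSum g T}
  swap
  · rw [Set.indicator_of_notMem hb]
    exact add_nonneg (hnn _) (hnn _)
  by_cases hloc : ∃ i ∈ T, D < ((T.erase i).filter (adj i)).card
  · rw [Set.indicator_of_mem hb, Set.indicator_of_mem (s := {T | ∃ i ∈ T, _}) hloc]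
    exact le_add_of_nonneg_left (hnn _)
  · rw [Set.indicator_of_mem hb, Set.indicator_of_mem (s := {T | b ≤ pairSum g T ∧ _})]
    · exact le_add_of_nonneg_right (hnn _)
    push Not at hloc
    refine ⟨hb, fun i hi => ?_⟩
    calc localSum g T i ≤ ∑ j ∈ T.erase i, if adj i j then c else 0 :=
          Finset.sum_le_sum fun j _ => hgc i j
      _ = c * ((T.erase i).filter (adj i)).card := by
          rw [← Finset.sum_filter, Finset.sum_const, nsmul_eq_mul, mul_comm]
      _ ≤ c * D := mul_le_mul_of_nonneg_left (hloc i hi) hc.le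

end PairSum

open Gilbert Filter Topology ProbabilityTheory

/-! ### Discretised Poisson processes -/

section Poisson

variable {d : ℕ} {W : Set (E d)}

theorem Gilbert.PointConfig.measurable_count {A : Set (E d)} (hA : MeasurableSet A) (hAW : A ⊆ W) :
    Measurable fun ξ : PointConfig W => ξ.count A := by
  rw [measurable_iff_comap_le]
  exact le_iSup_of_le A (le_iSup_of_le hA (le_iSup_of_le hAW le_rfl))

theorem Gilbert.PointConfig.count_eq_zero_iff {ξ : PointConfig W} {A : Set (E d)} :
    ξ.count A = 0 ↔ ∀ x ∈ ξ.points, x ∉ A := by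
  rw [PointConfig.count, Set.ncard_eq_zero (ξ.points.finite_toSet.inter_of_left A),
    Set.eq_empty_iff_forall_notMem]
  simp

open Classical in
theorem image_points_eq_iff {c : SimpleFunc (E d) (E d)} {T : Finset (E d)} (hT : T ⊆ c.range)
    (ξ : PointConfig W) :
    ξ.points.image c = T ↔ ∀ i ∈ c.range, (i ∈ T ↔ ξ.count (W ∩ c ⁻¹' {i}) ≠ 0) := by
  have hmem : ∀ i, ξ.count (W ∩ c ⁻¹' {i}) ≠ 0 ↔ i ∈ ξ.points.image c := by
    intro i
    rw [Ne, PointConfig.count_eq_zero_iff]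
    simp only [Set.mem_inter_iff, Set.mem_preimage, Set.mem_singleton_iff, not_forall, not_not,
      Finset.mem_image, exists_prop]
    exact ⟨fun ⟨x, hx, _, h⟩ => ⟨x, hx, h⟩, fun ⟨x, hx, h⟩ => ⟨x, hx, ξ.subset hx, h⟩⟩
  simp only [hmem]
  refine ⟨fun h i _ => h ▸ Iff.rfl, fun h => ?_⟩
  ext i
  refine ⟨fun hi => ?_, fun hi => (h i (hT hi)).1 hi⟩
  obtain ⟨x, -, rfl⟩ := Finset.mem_image.1 hi
  exact (h _ (c.mem_range_self x)).2 hi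

open Classical in
theorem setOf_image_points_mem {Ω : Type*} {η : Ω → PointConfig W} (c : SimpleFunc (E d) (E d))
    (A : Set (Finset (E d))) : {ω | (η ω).points.image c ∈ A} =
      ⋃ T ∈ c.range.powerset.filter (· ∈ A), {ω | (η ω).points.image c = T} := by
  ext ω
  simp only [Set.mem_ofPred_eq, Set.mem_iUnion, Finset.mem_filter, Finset.mem_powerset,
    exists_prop]
  refine ⟨fun h => ⟨_, ⟨fun i hi => ?_, h⟩, rfl⟩, ?_⟩
  · obtain ⟨x, -, rfl⟩ := Finset.mem_image.1 hi
    exact c.mem_range_self x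
  · rintro ⟨T, ⟨-, hT⟩, rfl⟩
    exact hT

variable {Ω : Type*} [MeasurableSpace Ω] {P : Measure Ω} {t : ℝ} {η : Ω → PointConfig W}

theorem measurableSet_cell_empty (hη : IsPoissonProcess P W t η) (hW : IsCompact W)
    (c : SimpleFunc (E d) (E d)) (i : E d) :
    MeasurableSet {ω | (η ω).count (W ∩ c ⁻¹' {i}) = 0} :=
  ((PointConfig.measurable_count (hW.measurableSet.inter (c.measurableSet_fiber i))
    Set.inter_subset_left).comp hη.measurable) (measurableSet_singleton 0)

open Classical in
theorem measurableSet_image_points_eq (hη : IsPoissonProcess P W t η) (hW : IsCompact W)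
    (c : SimpleFunc (E d) (E d)) {T : Finset (E d)} (hT : T ⊆ c.range) :
    MeasurableSet {ω | (η ω).points.image c = T} := by
  simp only [image_points_eq_iff hT, Set.ofPred_forall]
  refine c.range.measurableSet_biInter fun i _ => ?_
  by_cases hi : i ∈ T
  · have h : MeasurableSet {ω | (η ω).count (W ∩ c ⁻¹' {i}) ≠ 0} :=
      (measurableSet_cell_empty hη hW c i).compl
    simpa only [hi, true_iff] using h
  · simpa only [hi, false_iff, not_not] using measurableSet_cell_empty hη hW c i

open Classical in
theorem measurableSet_image_points_mem (hη : IsPoissonProcess P W t η) (hW : IsCompact W)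
    (c : SimpleFunc (E d) (E d)) (A : Set (Finset (E d))) :
    MeasurableSet {ω | (η ω).points.image c ∈ A} := by
  rw [setOf_image_points_mem]
  exact Finset.measurableSet_biUnion _ fun T hT => measurableSet_image_points_eq hη hW c
    (Finset.mem_powerset.1 (Finset.mem_filter.1 hT).1)

variable [IsProbabilityMeasure P]

/-- The probability that the cell with label `i` contains a point of the Poisson process. -/
noncomputable def cellProb (W : Set (E d)) (t : ℝ) (c : SimpleFunc (E d) (E d)) (i : E d) : ℝ :=
  1 - Real.exp (-(t * volume.real (W ∩ c ⁻¹' {i})))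

theorem cellProb_mem_Icc (ht : 0 ≤ t) (c : SimpleFunc (E d) (E d)) (i : E d) :
    cellProb W t c i ∈ Set.Icc (0 : ℝ) 1 := by
  have h : 0 ≤ t * volume.real (W ∩ c ⁻¹' {i}) := by positivity
  refine ⟨sub_nonneg.2 (Real.exp_le_one_iff.2 (neg_nonpos.2 h)), ?_⟩
  exact sub_le_self _ (Real.exp_pos _).le

theorem sum_cellProb_le (ht : 0 ≤ t) (hW : IsCompact W) (c : SimpleFunc (E d) (E d))
    (R : Finset (E d)) {V : Set (E d)} (hV : volume V ≠ ⊤) (hR : ∀ x ∈ W, c x ∈ R → x ∈ V) :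
    ∑ i ∈ R, cellProb W t c i ≤ t * volume.real V := by
  have h1 : ∑ i ∈ R, cellProb W t c i ≤ ∑ i ∈ R, t * volume.real (W ∩ c ⁻¹' {i}) := by
    refine Finset.sum_le_sum fun i _ => ?_
    have := Real.add_one_le_exp (-(t * volume.real (W ∩ c ⁻¹' {i})))
    rw [cellProb]
    linarith
  refine h1.trans ?_
  rw [← Finset.mul_sum, ← measureReal_biUnion_finset (s := R)
    (fun i _ j _ hij => Set.disjoint_left.2 fun x hx hx' => hij (hx.2.symm.trans hx'.2))
    (fun i _ => hW.measurableSet.inter (c.measurableSet_fiber i))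
    (fun i _ => measure_ne_top_of_subset Set.inter_subset_left hW.measure_lt_top.ne)]
  refine mul_le_mul_of_nonneg_left (measureReal_mono ?_ hV) ht
  refine Set.iUnion₂_subset fun i hi x hx => hR x hx.1 ?_
  rwa [show c x = i from hx.2]

theorem iIndepSet_cell_empty (hη : IsPoissonProcess P W t η) (hW : IsCompact W)
    (c : SimpleFunc (E d) (E d)) :
    iIndepSet (fun i => {ω | (η ω).count (W ∩ c ⁻¹' {i}) = 0}) P := by
  have hcell : ∀ i, MeasurableSet (W ∩ c ⁻¹' {i}) := fun i =>
    hW.measurableSet.inter (c.measurableSet_fiber i)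
  rw [iIndepSet_iff_meas_biInter (measurableSet_cell_empty hη hW c)]
  intro s
  have hset : (⋂ i ∈ s, {ω | (η ω).count (W ∩ c ⁻¹' {i}) = 0}) =
      {ω | (η ω).count (⋃ i ∈ s, W ∩ c ⁻¹' {i}) = 0} := by
    ext ω
    simp only [Set.mem_iInter, Set.mem_ofPred_eq, PointConfig.count_eq_zero_iff, Set.mem_iUnion,
      not_exists]
    tauto
  rw [hset, ← ENNReal.toReal_eq_toReal_iff' (measure_ne_top _ _)
    (ENNReal.prod_ne_top fun _ _ => measure_ne_top _ _), ENNReal.toReal_prod]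
  simp only [← measureReal_def]
  rw [hη.void_prob _ (s.measurableSet_biUnion fun i _ => hcell i)
    (Set.iUnion₂_subset fun i _ => Set.inter_subset_left),
    measureReal_biUnion_finset (s := s)
    (fun i _ j _ hij => Set.disjoint_left.2 fun x hx hx' => hij (hx.2.symm.trans hx'.2))
    (fun i _ => hcell i)
    (fun i _ => measure_ne_top_of_subset Set.inter_subset_left hW.measure_lt_top.ne),
    Finset.mul_sum, ← Finset.sum_neg_distrib, Real.exp_sum]
  exact Finset.prod_congr rfl fun i _ => (hη.void_prob _ (hcell i) Set.inter_subset_left).symm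

open Classical in
/-- The void probabilities make the events that single cells are empty independent; this gives the
law of the set of labels of the occupied cells. -/
theorem prob_image_points_eq (hη : IsPoissonProcess P W t η) (hW : IsCompact W)
    (c : SimpleFunc (E d) (E d)) {T : Finset (E d)} (hT : T ⊆ c.range) :
    P.real {ω | (η ω).points.image c = T} = bernoulliWeight (cellProb W t c) c.range T := by
  set B : E d → Set Ω := fun i => {ω | (η ω).count (W ∩ c ⁻¹' {i}) = 0} with hB
  have hcell : ∀ i, MeasurableSet (W ∩ c ⁻¹' {i}) := fun i =>
    hW.measurableSet.inter (c.measurableSet_fiber i)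
  have hBp : ∀ i, P.real (B i) = 1 - cellProb W t c i := fun i => by
    rw [hη.void_prob _ (hcell i) Set.inter_subset_left, cellProb, sub_sub_cancel]
  have hset : {ω | (η ω).points.image c = T} =
      ⋂ i ∈ c.range, if i ∈ T then (B i)ᶜ else B i := by
    ext ω
    simp only [Set.mem_ofPred_eq, image_points_eq_iff hT, Set.mem_iInter]
    refine forall₂_congr fun i _ => ?_
    by_cases hi : i ∈ T <;> simp [hi, hB]
  have hind : iIndep (fun i => MeasurableSpace.generateFrom {B i}) P :=
    iIndepSet_cell_empty hη hW c
  have hBg : ∀ i, MeasurableSet[MeasurableSpace.generateFrom {B i}] (B i) := fun i =>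
    MeasurableSpace.measurableSet_generateFrom rfl
  rw [hset, measureReal_def, hind.meas_biInter fun i _ => ?_, ENNReal.toReal_prod,
    ← Finset.prod_sdiff hT, mul_comm, bernoulliWeight]
  · congr 1
    · refine Finset.prod_congr rfl fun i hi => ?_
      rw [if_pos hi, ← measureReal_def,
        probReal_compl_eq_one_sub (measurableSet_cell_empty hη hW c i), hBp, sub_sub_cancel]
    · refine Finset.prod_congr rfl fun i hi => ?_
      rw [if_neg (Finset.mem_sdiff.1 hi).2, ← measureReal_def, hBp]
  · split_ifs
    exacts [(hBg i).compl, hBg i]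

open Classical in
/-- The set of labels of the occupied cells is a random subset with independent memberships. -/
theorem prob_image_points_mem (hη : IsPoissonProcess P W t η) (hW : IsCompact W)
    (c : SimpleFunc (E d) (E d)) (A : Set (Finset (E d))) :
    P.real {ω | (η ω).points.image c ∈ A} = bernoulliProb (cellProb W t c) c.range A := by
  have hsub : ∀ T ∈ c.range.powerset.filter (· ∈ A), T ⊆ c.range := fun T hT =>
    Finset.mem_powerset.1 (Finset.mem_filter.1 hT).1
  have hdisj : ∀ T T' : Finset (E d), T ≠ T' →
      Disjoint {ω | (η ω).points.image c = T} {ω | (η ω).points.image c = T'} := fun T T' hne =>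
    Set.disjoint_left.2 fun ω h h' => hne (Eq.trans (Eq.symm h) h')
  rw [setOf_image_points_mem, measureReal_biUnion_finset (fun T _ T' _ hne => hdisj T T' hne)
    fun T hT => measurableSet_image_points_eq hη hW c (hsub T hT), bernoulliProb, bernoulliMean,
    Finset.sum_filter]
  refine Finset.sum_congr rfl fun T hT => ?_
  by_cases hA : T ∈ A
  · simp [hA, prob_image_points_eq hη hW c (Finset.mem_powerset.1 hT)]
  · simp [hA]

/-- A compact set is partitioned into finitely many measurable cells, with labels that are
`ε`-close to the points of the cell. -/
theorem IsCompact.exists_simpleFunc_dist_le (hW : IsCompact W) {ε : ℝ} (hε : 0 < ε) :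
    ∃ c : SimpleFunc (E d) (E d), ∀ x ∈ W, dist x (c x) ≤ ε := by
  obtain ⟨u, -, hu, hWu⟩ := hW.finite_cover_balls hε
  have h : ∀ u : Finset (E d), ∃ c : SimpleFunc (E d) (E d),
      ∀ y ∈ u, ∀ x ∈ Metric.ball y ε, dist x (c x) ≤ ε := by
    classical
    intro u
    induction u using Finset.induction_on with
    | empty => exact ⟨SimpleFunc.const _ 0, by simp⟩
    | insert a u _ ih =>
      obtain ⟨c, hc⟩ := ih
      refine ⟨SimpleFunc.piecewise (Metric.ball a ε) measurableSet_ball (SimpleFunc.const _ a) c,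
        fun y hy x hx => ?_⟩
      rw [SimpleFunc.piecewise_apply]
      split_ifs with hxa
      · exact (Metric.mem_ball.1 hxa).le
      · obtain rfl | hy := Finset.mem_insert.1 hy
        · exact absurd hx hxa
        · exact hc y hy x hx
  obtain ⟨c, hc⟩ := h hu.toFinset
  refine ⟨c, fun x hx => ?_⟩
  obtain ⟨y, hy, hxy⟩ := Set.mem_iUnion₂.1 (hWu hx)
  exact hc y (hu.mem_toFinset.2 hy) x hxy

/-! ### The Gilbert graph of a discretised configuration -/

/-- The length-power kernel of the Gilbert graph with distance parameter `ρ`, with lengths cut off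
at `δ`. The discretised process uses a parameter `ρ` slightly above `δ`, so that no edge of the
Gilbert graph with parameter `δ` is lost. -/
noncomputable def gilbertKernel (α δ ρ : ℝ) (x y : E d) : ℝ :=
  if ‖x - y‖ ≤ ρ then min ‖x - y‖ δ ^ α else 0

theorem gilbertKernel_nonneg {α δ ρ : ℝ} (hδ : 0 ≤ δ) (x y : E d) :
    0 ≤ gilbertKernel α δ ρ x y := by
  unfold gilbertKernel
  split_ifs <;> positivity

theorem gilbertKernel_comm (α δ ρ : ℝ) (x y : E d) :
    gilbertKernel α δ ρ x y = gilbertKernel α δ ρ y x := by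
  rw [gilbertKernel, gilbertKernel, norm_sub_rev]

theorem gilbertKernel_le {α δ ρ : ℝ} (hδ : 0 ≤ δ) (hα : 0 ≤ α) (x y : E d) :
    gilbertKernel α δ ρ x y ≤ if ‖x - y‖ ≤ ρ then δ ^ α else 0 := by
  unfold gilbertKernel
  split_ifs
  · exact Real.rpow_le_rpow (by positivity) (min_le_right _ _) hα
  · exact le_rfl

open Classical in
theorem lengthPower_eq_pairSum (α δ : ℝ) (ξ : PointConfig W) :
    lengthPower α δ ξ = pairSum (gilbertKernel α δ δ) ξ.points := by
  unfold lengthPower pairSum gilbertKernel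
  congr 1
  refine Finset.sum_congr rfl fun x _ => ?_
  split_ifs with h
  · rw [min_eq_left h]
  · rfl

theorem tendsto_gilbertKernel {α δ : ℝ} (hα : 0 ≤ α) {x y : E d} {c : ℕ → E d → E d}
    {ε : ℕ → ℝ} (hε : Tendsto ε atTop (𝓝 0)) (hx : ∀ n, dist x (c n x) ≤ ε n)
    (hy : ∀ n, dist y (c n y) ≤ ε n) :
    Tendsto (fun n => gilbertKernel α δ (δ + 2 * ε n) (c n x) (c n y)) atTop
      (𝓝 (gilbertKernel α δ δ x y)) := by
  have hlim : ∀ {z : E d}, (∀ n, dist z (c n z) ≤ ε n) → Tendsto (fun n => c n z) atTop (𝓝 z) :=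
    fun {z} hz => tendsto_iff_dist_tendsto_zero.2 <|
      squeeze_zero (fun _ => dist_nonneg) (fun n => by rw [dist_comm]; exact hz n) hε
  have hnorm : Tendsto (fun n => ‖c n x - c n y‖) atTop (𝓝 ‖x - y‖) :=
    ((hlim hx).sub (hlim hy)).norm
  by_cases h : ‖x - y‖ ≤ δ
  · have hadj : ∀ n, ‖c n x - c n y‖ ≤ δ + 2 * ε n := fun n => by
      have h1 := hx n
      have h2 := hy n
      have h3 := dist_triangle4 (c n x) x y (c n y)
      rw [← dist_eq_norm] at h ⊢
      rw [dist_comm (c n x) x] at h3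
      linarith
    simp only [gilbertKernel, hadj, h, if_true]
    exact (hnorm.min tendsto_const_nhds).rpow_const (Or.inr hα)
  · push Not at h
    have hρ : Tendsto (fun n => δ + 2 * ε n) atTop (𝓝 δ) := by
      simpa using (hε.const_mul 2).const_add δ
    have hev : ∀ᶠ n in atTop, δ + 2 * ε n < ‖c n x - c n y‖ := hρ.eventually_lt hnorm h
    rw [gilbertKernel, if_neg h.not_ge]
    refine tendsto_const_nhds.congr' ?_
    filter_upwards [hev] with n hn
    rw [gilbertKernel, if_neg hn.not_ge]

open Classical in
/-- The pair sums of the discretised configurations converge: eventually distinct points lie in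
distinct cells. -/
theorem tendsto_pairSum_image {α δ : ℝ} (hα : 0 ≤ α) {F : Finset (E d)} {c : ℕ → E d → E d}
    {ε : ℕ → ℝ} (hε : Tendsto ε atTop (𝓝 0)) (hc : ∀ n, ∀ x ∈ F, dist x (c n x) ≤ ε n) :
    Tendsto (fun n => pairSum (gilbertKernel α δ (δ + 2 * ε n)) (F.image (c n))) atTop
      (𝓝 (pairSum (gilbertKernel α δ δ) F)) := by
  have hinj : ∀ᶠ n in atTop, Set.InjOn (c n) F := by
    have h : ∀ᶠ n in atTop, ∀ x ∈ F, ∀ y ∈ F, x ≠ y → c n x ≠ c n y := by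
      rw [eventually_all_finset]
      intro x hx
      rw [eventually_all_finset]
      intro y hy
      by_cases hxy : x = y
      · simp [hxy]
      have hev : ∀ᶠ n in atTop, ε n < dist x y / 2 :=
        hε.eventually_lt_const (half_pos (dist_pos.2 hxy))
      filter_upwards [hev] with n hn _ heq
      have h1 := dist_triangle_right x y (c n x)
      have h2 := hc n x hx
      have h3 := hc n y hy
      rw [← heq] at h3
      linarith
    filter_upwards [h] with n hn x hx y hy hxy
    by_contra hne
    exact hn x hx y hy hne hxy
  have heq : (fun n => (1 / 2) * ∑ x ∈ F, ∑ y ∈ F,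
      if x ≠ y then gilbertKernel α δ (δ + 2 * ε n) (c n x) (c n y) else 0) =ᶠ[atTop]
      fun n => pairSum (gilbertKernel α δ (δ + 2 * ε n)) (F.image (c n)) := by
    filter_upwards [hinj] with n hn
    rw [pairSum, sum_offDiag_eq_sum_ite, Finset.sum_image hn]
    congr 1
    refine Finset.sum_congr rfl fun x hx => ?_
    rw [Finset.sum_image hn]
    refine Finset.sum_congr rfl fun y hy => ?_
    simp only [ne_eq, hn.eq_iff hx hy]
  refine Tendsto.congr' heq ?_
  rw [pairSum, sum_offDiag_eq_sum_ite]
  refine Tendsto.const_mul _ (tendsto_finsetSum _ fun x hx => tendsto_finsetSum _ fun y hy => ?_)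
  split_ifs
  · exact tendsto_gilbertKernel hα hε (fun n => hc n x hx) fun n => hc n y hy
  · exact tendsto_const_nhds

theorem volume_real_closedBall (x : E d) {r : ℝ} (hr : 0 ≤ r) :
    volume.real (Metric.closedBall x r) = κ d * r ^ d := by
  rw [measureReal_def, Measure.addHaar_closedBall' volume x hr, ENNReal.toReal_mul,
    ENNReal.toReal_ofReal (by positivity), finrank_euclideanSpace_fin, κ, measureReal_def, mul_comm]

open Classical in
/-- The two-level inequality for the discretised process. As cells have radius `ε`, the neighbours
of a label lie in cells contained in a ball of radius `δ + 3 * ε`. -/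
theorem prob_pairSum_image_mul_sub_le (hη : IsPoissonProcess P W t η) (hW : IsCompact W)
    (ht : 0 ≤ t) {α δ ε s a b D : ℝ} (hα : 0 ≤ α) (hδ : 0 < δ) (hε : 0 ≤ ε) (hs : 0 ≤ s)
    (ha : 0 ≤ a) (hab : a < b) (hD : 0 < D) {c : SimpleFunc (E d) (E d)}
    (hc : ∀ x ∈ W, dist x (c x) ≤ ε) :
    P.real {ω | pairSum (gilbertKernel α δ (δ + 2 * ε)) ((η ω).points.image c) ≤ a} *
      (P.real {ω | b ≤ pairSum (gilbertKernel α δ (δ + 2 * ε)) ((η ω).points.image c)} -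
        t * volume.real W * Real.exp ((Real.exp s - 1) * (t * (κ d * (δ + 3 * ε) ^ d)) - s * D)) ≤
      Real.exp (-((b - a) ^ 2 / (8 * b * (δ ^ α * D)))) := by
  have h1 := prob_image_points_mem hη hW c {T | pairSum (gilbertKernel α δ (δ + 2 * ε)) T ≤ a}
  have h2 := prob_image_points_mem hη hW c {T | b ≤ pairSum (gilbertKernel α δ (δ + 2 * ε)) T}
  simp only [Set.mem_ofPred_eq] at h1 h2
  rw [h1, h2]
  refine bernoulliProb_pairSum_mul_sub_le hs (cellProb_mem_Icc ht c)
    (fun x y => ‖x - y‖ ≤ δ + 2 * ε) (gilbertKernel_nonneg hδ.le) (gilbertKernel_comm α δ _)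
    (gilbertKernel_le hδ.le hα) ha hab (by positivity) hD (fun i _ => ?_) ?_
  · rw [← volume_real_closedBall i (by positivity)]
    refine sum_cellProb_le ht hW c _ measure_closedBall_lt_top.ne fun x hx hcx => ?_
    have h3 := (Finset.mem_filter.1 hcx).2
    rw [← dist_eq_norm, dist_comm] at h3
    have h4 := dist_triangle x (c x) i
    have h5 := hc x hx
    rw [Metric.mem_closedBall]
    linarith
  · exact sum_cellProb_le ht hW c _ hW.measure_lt_top.ne fun x hx _ => hx

/-! ### Passage to the limit -/

/-- A two-level inequality, valid for all levels, passes to pointwise limits. -/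
theorem prob_mul_sub_le_of_tendsto {X : ℕ → Ω → ℝ} {Y : Ω → ℝ} {G : ℕ → ℝ} {q M : ℝ}
    (hX : ∀ n, Measurable (X n)) (hXY : ∀ ω, Tendsto (fun n => X n ω) atTop (𝓝 (Y ω)))
    (hG : Tendsto G atTop (𝓝 q)) (hM : 0 < M)
    (H : ∀ n, ∀ a b : ℝ, 0 ≤ a → a < b → P.real {ω | X n ω ≤ a} *
      (P.real {ω | b ≤ X n ω} - G n) ≤ Real.exp (-((b - a) ^ 2 / (8 * b * M))))
    {a b : ℝ} (ha : 0 ≤ a) (hab : a < b) :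
    P.real {ω | Y ω ≤ a} * (P.real {ω | b ≤ Y ω} - q) ≤
      Real.exp (-((b - a) ^ 2 / (8 * b * M))) := by
  rcases le_or_gt (P.real {ω | b ≤ Y ω} - q) 0 with hq | hq
  · exact (mul_nonpos_of_nonneg_of_nonpos measureReal_nonneg hq).trans (Real.exp_pos _).le
  have hb : 0 < b := ha.trans_lt hab
  have hin : TendstoInMeasure P X atTop Y :=
    tendstoInMeasure_of_tendsto_ae (fun n => (hX n).aestronglyMeasurable)
      (Eventually.of_forall hXY)
  have hε : ∀ ε ∈ Set.Ioo 0 ((b - a) / 2), P.real {ω | Y ω ≤ a} * (P.real {ω | b ≤ Y ω} - q) ≤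
      Real.exp (-((b - ε - (a + ε)) ^ 2 / (8 * (b - ε) * M))) := by
    rintro ε ⟨hε0, hε1⟩
    have hr := (tendstoInMeasure_iff_measureReal_dist.1 hin) ε hε0
    set r : ℕ → ℝ := fun n => P.real {ω | ε ≤ dist (X n ω) (Y ω)}
    have h1 : ∀ n, P.real {ω | Y ω ≤ a} - r n ≤ P.real {ω | X n ω ≤ a + ε} := fun n => by
      rw [sub_le_iff_le_add]
      refine (measureReal_mono fun ω hω => ?_).trans (measureReal_union_le _ _)
      by_contra hnot
      simp only [Set.mem_union, Set.mem_ofPred_eq, not_or, not_le, Real.dist_eq, abs_lt] at hnot hω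
      linarith [hnot.2.2]
    have h2 : ∀ n, P.real {ω | b ≤ Y ω} - r n ≤ P.real {ω | b - ε ≤ X n ω} := fun n => by
      rw [sub_le_iff_le_add]
      refine (measureReal_mono fun ω hω => ?_).trans (measureReal_union_le _ _)
      by_contra hnot
      simp only [Set.mem_union, Set.mem_ofPred_eq, not_or, not_le, Real.dist_eq, abs_lt] at hnot hω
      linarith [hnot.2.1]
    have hlim2 : Tendsto (fun n => P.real {ω | b ≤ Y ω} - r n - G n) atTop
        (𝓝 (P.real {ω | b ≤ Y ω} - q)) := by
      simpa using (tendsto_const_nhds.sub hr).sub hG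
    have hlim : Tendsto (fun n => (P.real {ω | Y ω ≤ a} - r n) *
        (P.real {ω | b ≤ Y ω} - r n - G n)) atTop
        (𝓝 (P.real {ω | Y ω ≤ a} * (P.real {ω | b ≤ Y ω} - q))) := by
      have := (tendsto_const_nhds (x := P.real {ω | Y ω ≤ a})).sub hr
      rw [sub_zero] at this
      exact this.mul hlim2
    refine le_of_tendsto hlim ?_
    filter_upwards [hlim2.eventually_const_lt hq] with n hn
    calc _ ≤ P.real {ω | X n ω ≤ a + ε} * (P.real {ω | b ≤ Y ω} - r n - G n) :=
          mul_le_mul_of_nonneg_right (h1 n) hn.le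
      _ ≤ P.real {ω | X n ω ≤ a + ε} * (P.real {ω | b - ε ≤ X n ω} - G n) :=
          mul_le_mul_of_nonneg_left (sub_le_sub_right (h2 n) _) measureReal_nonneg
      _ ≤ _ := H n _ _ (by linarith) (by linarith)
  have hcont : ContinuousAt
      (fun ε : ℝ => Real.exp (-((b - ε - (a + ε)) ^ 2 / (8 * (b - ε) * M)))) 0 := by
    have : 8 * (b - 0) * M ≠ 0 := by simp [hb.ne', hM.ne']
    fun_prop (disch := assumption)
  have hlim : Tendsto (fun ε : ℝ => Real.exp (-((b - ε - (a + ε)) ^ 2 / (8 * (b - ε) * M))))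
      (𝓝[>] 0) (𝓝 (Real.exp (-((b - a) ^ 2 / (8 * b * M))))) := by
    have := hcont.tendsto.mono_left (nhdsWithin_le_nhds (s := Set.Ioi 0))
    simpa using this
  refine ge_of_tendsto hlim ?_
  filter_upwards [Ioo_mem_nhdsGT (show (0 : ℝ) < (b - a) / 2 by linarith)] with ε hε' using hε ε hε'

/-- The convex distance inequality for the length-power functional of the Gilbert graph of a Poisson
process. The subtracted term bounds the probability of a vertex of degree more than `D`. -/
theorem prob_lengthPower_mul_sub_le (hη : IsPoissonProcess P W t η) (hW : IsCompact W)
    (ht : 0 ≤ t) {α δ s a b D : ℝ} (hα : 0 ≤ α) (hδ : 0 < δ) (hs : 0 ≤ s)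
    (ha : 0 ≤ a) (hab : a < b) (hD : 0 < D) :
    P.real {ω | lengthPower α δ (η ω) ≤ a} *
      (P.real {ω | b ≤ lengthPower α δ (η ω)} -
        t * volume.real W * Real.exp ((Real.exp s - 1) * (t * (κ d * δ ^ d)) - s * D)) ≤
      Real.exp (-((b - a) ^ 2 / (8 * b * (δ ^ α * D)))) := by
  classical
  have hεpos : ∀ n : ℕ, (0 : ℝ) < 1 / (n + 1) := fun n => by positivity
  have hε : Tendsto (fun n : ℕ => (1 : ℝ) / (n + 1)) atTop (𝓝 0) :=
    tendsto_one_div_add_atTop_nhds_zero_nat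
  choose c hc using fun n : ℕ => hW.exists_simpleFunc_dist_le (hεpos n)
  refine prob_mul_sub_le_of_tendsto
    (X := fun n ω => pairSum (gilbertKernel α δ (δ + 2 * (1 / ((n : ℝ) + 1))))
      ((η ω).points.image (c n)))
    (G := fun n : ℕ => t * volume.real W *
      Real.exp ((Real.exp s - 1) * (t * (κ d * (δ + 3 * (1 / ((n : ℝ) + 1))) ^ d)) - s * D))
    (fun n B _ => measurableSet_image_points_mem hη hW (c n)
      (pairSum (gilbertKernel α δ (δ + 2 * (1 / ((n : ℝ) + 1)))) ⁻¹' B))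
    (fun ω => ?_) ?_ (by positivity)
    (fun n a b ha hab => prob_pairSum_image_mul_sub_le hη hW ht hα hδ (hεpos n).le hs ha hab hD
      (hc n)) ha hab
  · simp only [lengthPower_eq_pairSum]
    exact tendsto_pairSum_image hα hε fun n x hx => hc n x ((η ω).subset hx)
  · have hcont : Continuous fun ε : ℝ => t * volume.real W *
        Real.exp ((Real.exp s - 1) * (t * (κ d * (δ + 3 * ε) ^ d)) - s * D) := by fun_prop
    have := (hcont.tendsto 0).comp hε
    simpa [Function.comp_def] using this

end Poisson

/-! ### Concentration around the median -/

section Median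

theorem lengthPower_nonneg {d : ℕ} {W : Set (E d)} (α δ : ℝ) (ξ : PointConfig W) :
    0 ≤ lengthPower α δ ξ := by
  refine mul_nonneg (by norm_num) (Finset.sum_nonneg fun x _ => ?_)
  split_ifs <;> positivity

theorem Gilbert.IsMedian.nonneg {Ω : Type*} [MeasurableSpace Ω] {P : Measure Ω} {X : Ω → ℝ} {m : ℝ}
    (hm : IsMedian P X m) (hX : ∀ ω, 0 ≤ X ω) : 0 ≤ m := by
  by_contra hneg
  have hempty : {ω | X ω ≤ m} = ∅ := by
    ext ω
    simpa using (not_le.1 hneg).trans_le (hX ω)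
  have := hm.1
  rw [hempty, measureReal_empty] at this
  norm_num at this

variable {Ω : Type*} [MeasurableSpace Ω] {P : Measure Ω} [IsProbabilityMeasure P] {X : Ω → ℝ}
  {m : ℝ}

/-- A two-level inequality for `X` turns into a two-sided deviation inequality around a median. -/
theorem Gilbert.IsMedian.prob_abs_sub_le (hm : IsMedian P X m) (hX : ∀ ω, 0 ≤ X ω) {u C g : ℝ}
    (hu : 0 < u) (hC : 0 < C) (hg : g ≤ Real.exp (-(u ^ 2 / (8 * C * (u + m)))))
    (H : ∀ a b : ℝ, 0 ≤ a → a < b → P.real {ω | X ω ≤ a} * (P.real {ω | b ≤ X ω} - g) ≤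
      Real.exp (-((b - a) ^ 2 / (8 * b * C)))) :
    P.real {ω | u ≤ |X ω - m|} ≤ 8 * Real.exp (-(u ^ 2 / (8 * C * (u + m)))) := by
  have hm0 := hm.nonneg hX
  set e := Real.exp (-(u ^ 2 / (8 * C * (u + m)))) with he
  have he0 : 0 < e := Real.exp_pos _
  -- For `e ≥ 1 / 8` the bound exceeds `1`; below, `g ≤ e < 1 / 8` leaves `1 / 2 - g ≥ 3 / 8`.
  rcases le_or_gt (1 / 8) e with h8 | h8
  · exact measureReal_le_one.trans (by linarith)
  have hunion : P.real {ω | u ≤ |X ω - m|} ≤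
      P.real {ω | m + u ≤ X ω} + P.real {ω | X ω ≤ m - u} := by
    refine (measureReal_mono fun ω hω => ?_).trans (measureReal_union_le _ _)
    simp only [Set.mem_union, Set.mem_ofPred_eq, le_abs] at hω ⊢
    rcases hω with h | h
    · exact Or.inl (by linarith)
    · exact Or.inr (by linarith)
  have hupper : P.real {ω | m + u ≤ X ω} ≤ 3 * e := by
    have h := H m (m + u) hm0 (by linarith)
    have hexp : Real.exp (-((m + u - m) ^ 2 / (8 * (m + u) * C))) = e := by
      rw [he]
      congr 3
      · ring
      · ring
    rw [hexp] at h
    rcases le_or_gt (P.real {ω | m + u ≤ X ω} - g) 0 with h0 | h0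
    · linarith
    · have := mul_le_mul_of_nonneg_right hm.1 h0.le
      linarith
  have hlower : P.real {ω | X ω ≤ m - u} ≤ 8 / 3 * e := by
    rcases lt_or_ge m u with hmu | hmu
    · have hempty : {ω | X ω ≤ m - u} = ∅ := by
        ext ω
        simpa using (sub_neg.2 hmu).trans_le (hX ω)
      rw [hempty, measureReal_empty]
      positivity
    · have h := H (m - u) m (by linarith) (by linarith)
      have hexp : Real.exp (-((m - (m - u)) ^ 2 / (8 * m * C))) ≤ e := by
        rw [he, Real.exp_le_exp, neg_le_neg_iff, sub_sub_cancel]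
        have hmpos : 0 < m := hu.trans_le hmu
        refine div_le_div_of_nonneg_left (sq_nonneg u) (by positivity) ?_
        have := mul_pos hC hu
        linarith
      have h1 : (3 / 8 : ℝ) ≤ P.real {ω | m ≤ X ω} - g := by
        have := hm.2
        linarith
      have h2 := mul_le_mul_of_nonneg_left h1
        (measureReal_nonneg (μ := P) (s := {ω | X ω ≤ m - u}))
      linarith
  linarith

end Median

section Deviation

variable {Ω : Type*} [MeasurableSpace Ω] {P : Measure Ω} [IsProbabilityMeasure P] {d : ℕ}
  {W : Set (E d)} {t δ α m u s : ℝ} {η : Ω → PointConfig W}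

theorem κ_pos (d : ℕ) : 0 < κ d :=
  ENNReal.toReal_pos (Metric.measure_closedBall_pos volume _ one_pos).ne'
    measure_closedBall_lt_top.ne

/-- Rewriting of the term under the square root in `xFun`. -/
theorem xFun_radicand_eq (hδ : 0 < δ) :
    u ^ 2 / (8 * t ^ 2 * κ d ^ 2 * δ ^ (2 * (d : ℝ) + α) * (u + m) * s) =
      u ^ 2 / (8 * (t * κ d * δ ^ d) ^ 2 * δ ^ α * (u + m)) / s := by
  have h : δ ^ (2 * (d : ℝ) + α) = (δ ^ d) ^ 2 * δ ^ α := by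
    rw [Real.rpow_add hδ, two_mul, Real.rpow_add hδ, Real.rpow_natCast, sq]
  rw [h, div_div]
  congr 1
  ring

theorem xFun_pos (ht : 0 < t) (hδ : 0 < δ) (hu : 0 < u) (hum : 0 < u + m) (hs : 0 < s)
    {V : ℝ} : 0 < xFun d α t δ V m u s := by
  have := κ_pos d
  have hc : 0 < u ^ 2 / (8 * t ^ 2 * κ d ^ 2 * δ ^ (2 * (d : ℝ) + α) * (u + m) * s) := by
    positivity
  have h1 : |xLinear d t δ V s| < √(u ^ 2 / (8 * t ^ 2 * κ d ^ 2 * δ ^ (2 * (d : ℝ) + α) *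
      (u + m) * s) + xLinear d t δ V s ^ 2) :=
    Real.lt_sqrt_of_sq_lt (by rw [sq_abs]; linarith)
  have h2 := neg_abs_le (xLinear d t δ V s)
  unfold xFun
  linarith

/-- `xFun` is the positive root of the quadratic equation that equates the two error terms, the one
of the convex distance inequality and the one of the degree bound. -/
theorem xFun_quadratic (ht : 0 < t) (hδ : 0 < δ) (hum : 0 < u + m) (hs : 0 < s) (V : ℝ) :
    s * xFun d α t δ V m u s ^ 2 -
      (Real.log (t * V) / (t * κ d * δ ^ d) + Real.exp s - 1) * xFun d α t δ V m u s =
        u ^ 2 / (8 * (t * κ d * δ ^ d) ^ 2 * δ ^ α * (u + m)) := by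
  have := κ_pos d
  set b := Real.log (t * V) / (t * κ d * δ ^ d) + Real.exp s - 1 with hb
  set c := u ^ 2 / (8 * (t * κ d * δ ^ d) ^ 2 * δ ^ α * (u + m)) with hc
  have hc0 : 0 ≤ c := by positivity
  have hx : xFun d α t δ V m u s = b / (2 * s) + √(c / s + (b / (2 * s)) ^ 2) := by
    rw [xFun, xFun_radicand_eq hδ, xLinear]
  have hsq := Real.sq_sqrt (show 0 ≤ c / s + (b / (2 * s)) ^ 2 by positivity)
  rw [hx]
  set r := √(c / s + (b / (2 * s)) ^ 2)
  calc s * (b / (2 * s) + r) ^ 2 - b * (b / (2 * s) + r) = s * (r ^ 2 - (b / (2 * s)) ^ 2) := by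
        field_simp
        ring
    _ = c := by
        rw [hsq]
        field_simp
        ring

/-- The deviation inequality before optimisation over `s`: the choice of `xFun` makes the bound for
the probability of a large degree equal to the main error term. -/
theorem prob_abs_sub_median_le_xFun (hη : IsPoissonProcess P W t η) (hW : IsCompact W)
    (hV : 0 < volume.real W) (ht : 0 < t) (hδ : 0 < δ) (hα : 0 ≤ α)
    (hm : IsMedian P (fun ω => lengthPower α δ (η ω)) m) (hu : 0 < u) (hs : 0 < s) :
    P.real {ω | u ≤ |lengthPower α δ (η ω) - m|} ≤
      8 * Real.exp (-(u ^ 2 / (8 * t * κ d * δ ^ ((d : ℝ) + α) *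
        xFun d α t δ (volume.real W) m u s * (u + m)))) := by
  have hκ := κ_pos d
  have hum : 0 < u + m := add_pos_of_pos_of_nonneg hu
    (hm.nonneg fun ω => lengthPower_nonneg α δ (η ω))
  have hx := xFun_pos (d := d) (α := α) (V := volume.real W) ht hδ hu hum hs
  have hquad := xFun_quadratic (d := d) (α := α) ht hδ hum hs (volume.real W)
  set x := xFun d α t δ (volume.real W) m u s
  set Λ := t * κ d * δ ^ d with hΛdef
  have hΛ : 0 < Λ := by positivity
  have hδα : 0 < δ ^ α := by positivity
  have hden : 8 * t * κ d * δ ^ ((d : ℝ) + α) * x * (u + m) =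
      8 * (δ ^ α * (Λ * x)) * (u + m) := by
    rw [Real.rpow_add hδ, Real.rpow_natCast, hΛdef]
    ring
  rw [hden]
  -- The degree threshold is `Λ * x`, that is, `x` times the expected degree bound `Λ`.
  refine hm.prob_abs_sub_le (fun ω => lengthPower_nonneg α δ (η ω)) hu (by positivity)
    (g := t * volume.real W * Real.exp ((Real.exp s - 1) * (t * (κ d * δ ^ d)) - s * (Λ * x)))
    (le_of_eq ?_) fun a b ha hab =>
      prob_lengthPower_mul_sub_le hη hW ht.le hα hδ hs.le ha hab (mul_pos hΛ hx)
  have htV : 0 < t * volume.real W := mul_pos ht hV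
  nth_rewrite 1 [← Real.exp_log htV]
  rw [← Real.exp_add]
  congr 1
  have h1 : u ^ 2 / (8 * (δ ^ α * (Λ * x)) * (u + m)) =
      Λ * (u ^ 2 / (8 * Λ ^ 2 * δ ^ α * (u + m))) / x := by
    field_simp
  rw [h1, ← hquad, ← mul_assoc t, ← hΛdef]
  field_simp
  ring

end Deviation

theorem theorem5p5
    {Ω : Type*} [MeasurableSpace Ω] (P : MeasureTheory.Measure Ω)
    [MeasureTheory.IsProbabilityMeasure P]
    (d : ℕ) (hd : 1 ≤ d)
    (W : Set (Gilbert.E d)) (hWcompact : IsCompact W) (hWconvex : Convex ℝ W)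
    (hWvol : 0 < MeasureTheory.volume.real W)
    (t : ℝ) (ht : 0 < t) (δ : ℝ) (hδ : 0 < δ) (α : ℝ) (hα : 0 ≤ α)
    (η : Ω → Gilbert.PointConfig W) (hη : Gilbert.IsPoissonProcess P W t η)
    (m : ℝ) (hm : Gilbert.IsMedian P (fun ω => Gilbert.lengthPower α δ (η ω)) m)
    (u : ℝ) (hu : 0 ≤ u) :
    P.real {ω | u ≤ |Gilbert.lengthPower α δ (η ω) - m|} ≤
      8 * Real.exp (-(u ^ 2 / (8 * t * Gilbert.κ d * δ ^ ((d : ℝ) + α) *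
        Gilbert.xStar d α t δ (MeasureTheory.volume.real W) m u * (u + m)))) ∧
    P.real {ω | u ≤ |Gilbert.lengthPower α δ (η ω) - m|} ≤
      8 * Real.exp (-((1 / 2) * min
        (u ^ 2 / (8 * (Real.log (t * MeasureTheory.volume.real W) * δ ^ α +
          2 * t * Gilbert.κ d * δ ^ ((d : ℝ) + α)) * (u + m)))
        (u / √(8 * δ ^ α * (u + m))))) := by
  have hκ := κ_pos d
  have hm0 : 0 ≤ m := hm.nonneg fun ω => lengthPower_nonneg α δ (η ω)
  have htriv : ∀ z : ℝ, z ≤ 0 →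
      P.real {ω | u ≤ |lengthPower α δ (η ω) - m|} ≤ 8 * Real.exp (-z) := fun z hz => by
    have h1 : P.real {ω | u ≤ |lengthPower α δ (η ω) - m|} ≤ 1 := measureReal_le_one
    have h2 := Real.one_le_exp (neg_nonneg.2 hz)
    linarith
  rcases hu.eq_or_lt with rfl | hu0
  · exact ⟨htriv _ (by simp), htriv _ (by simp)⟩
  have hum : 0 < u + m := add_pos_of_pos_of_nonneg hu0 hm0
  have hmain := fun {s : ℝ} (hs : 0 < s) =>
    prob_abs_sub_median_le_xFun hη hWcompact hWvol ht hδ hα hm hu0 hs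
  set V := volume.real W
  constructor
  · have hglb := xStar_isGLB d (α := α) (t := t) (V := V) (m := m) hδ hum.le
    have hx0 : 0 ≤ xStar d α t δ V m u := by
      refine hglb.2 ?_
      rintro _ ⟨s, hs, rfl⟩
      exact (xFun_pos ht hδ hu0 hum hs).le
    -- At `x* = 0` the exponent is a quotient by `0`, and the bound is the trivial one.
    rcases hx0.eq_or_lt with h0 | hpos
    · exact htriv _ (by simp [← h0])
    obtain ⟨x, -, -, hx, hmem⟩ :=
      hglb.exists_seq_antitone_tendsto ⟨_, 1, Set.mem_Ioi.2 one_pos, rfl⟩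
    have hcont : ContinuousAt (fun y : ℝ => 8 * Real.exp (-(u ^ 2 / (8 * t * κ d *
        δ ^ ((d : ℝ) + α) * y * (u + m))))) (xStar d α t δ V m u) := by
      have : 8 * t * κ d * δ ^ ((d : ℝ) + α) * xStar d α t δ V m u * (u + m) ≠ 0 := by positivity
      fun_prop (disch := assumption)
    refine ge_of_tendsto (hcont.tendsto.comp hx) (Eventually.of_forall fun n => ?_)
    obtain ⟨s, hs, hsx⟩ := hmem n
    rw [Function.comp_apply, ← hsx]
    exact hmain hs
  · set Λ := t * κ d * δ ^ d with hΛdef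
    have hΛ : 0 < Λ := by positivity
    have hδα : 0 < δ ^ α := by positivity
    set B := Real.log (t * V) / Λ + 2 with hB
    set y := √(8 * δ ^ α * (u + m)) with hy
    have hy0 : 0 < y := Real.sqrt_pos.2 (by positivity)
    have hysq : y ^ 2 = 8 * δ ^ α * (u + m) := Real.sq_sqrt (by positivity)
    have hrpow : δ ^ ((d : ℝ) + α) = δ ^ d * δ ^ α := by
      rw [Real.rpow_add hδ, Real.rpow_natCast]
    have hden : 8 * (Real.log (t * V) * δ ^ α + 2 * t * κ d * δ ^ ((d : ℝ) + α)) * (u + m) =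
        Λ * B * y ^ 2 := by
      have h1 : Λ * B = Real.log (t * V) + 2 * Λ := by
        rw [hB]
        field_simp
      rw [h1, hysq, hrpow, hΛdef]
      ring
    rw [hden]
    -- For `B ≤ 0` the first quotient is nonpositive (`0` by convention if `B = 0`).
    rcases le_or_gt B 0 with hB0 | hB0
    · have h1 : u ^ 2 / (Λ * B * y ^ 2) ≤ 0 :=
        div_nonpos_of_nonneg_of_nonpos (sq_nonneg u)
          (mul_nonpos_of_nonpos_of_nonneg (mul_nonpos_of_nonneg_of_nonpos hΛ.le hB0) (sq_nonneg y))
      have h2 := min_le_left (u ^ 2 / (Λ * B * y ^ 2)) (u / y)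
      exact htriv _ (by linarith)
    -- The explicit bound is the choice `s = 1`, with `exp 1 - 1 ≤ 2`.
    have hx0 : 0 < xFun d α t δ V m u 1 := xFun_pos ht hδ hu0 hum one_pos
    have hxle : xFun d α t δ V m u 1 ≤ B + u / (Λ * y) := by
      rw [xFun, xFun_radicand_eq hδ, ← hΛdef, div_one]
      have hsq : u ^ 2 / (8 * Λ ^ 2 * δ ^ α * (u + m)) = (u / (Λ * y)) ^ 2 := by
        rw [div_pow, mul_pow Λ y, hysq]
        congr 1
        ring
      have hlin : 2 * xLinear d t δ V 1 ≤ B := by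
        rw [xLinear, ← hΛdef, hB]
        have := Real.exp_one_lt_d9
        linarith
      rw [hsq]
      set l := xLinear d t δ V 1
      have hr : 0 ≤ u / (Λ * y) := by positivity
      have h1 : √((u / (Λ * y)) ^ 2 + l ^ 2) ≤ u / (Λ * y) + |l| := by
        refine Real.sqrt_le_iff.2 ⟨by positivity, ?_⟩
        nlinarith [mul_nonneg hr (abs_nonneg l), sq_abs l]
      rcases abs_cases l with ⟨h, -⟩ | ⟨h, -⟩ <;> linarith
    refine (hmain one_pos).trans (mul_le_mul_of_nonneg_left (Real.exp_le_exp.2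
      (neg_le_neg ?_)) (by norm_num))
    have hK : u ^ 2 / (8 * t * κ d * δ ^ ((d : ℝ) + α) * xFun d α t δ V m u 1 * (u + m)) =
        u ^ 2 / (Λ * xFun d α t δ V m u 1 * y ^ 2) := by
      rw [hysq, hrpow, hΛdef]
      congr 1
      ring
    rw [hK]
    set x := xFun d α t δ V m u 1
    rcases le_total B (u / (Λ * y)) with hc | hc
    · have h1 := min_le_right (u ^ 2 / (Λ * B * y ^ 2)) (u / y)
      have h2 : u ^ 2 / (Λ * (2 * (u / (Λ * y))) * y ^ 2) ≤ u ^ 2 / (Λ * x * y ^ 2) := by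
        gcongr
        linarith
      have h3 : u ^ 2 / (Λ * (2 * (u / (Λ * y))) * y ^ 2) = 1 / 2 * (u / y) := by
        field_simp
      linarith
    · have h1 := min_le_left (u ^ 2 / (Λ * B * y ^ 2)) (u / y)
      have h2 : u ^ 2 / (Λ * (2 * B) * y ^ 2) ≤ u ^ 2 / (Λ * x * y ^ 2) := by
        gcongr
        linarith
      have h3 : u ^ 2 / (Λ * (2 * B) * y ^ 2) = 1 / 2 * (u ^ 2 / (Λ * B * y ^ 2)) := by
        field_simp
      linarith
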